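/- **Setting.** Let $\mathcal G$ be a finite directed graph whose underlying undirected graph is a tree, with edges (pipes) $e_1,\dots,e_m$; pipe $e_k$ runs from the vertex $0_k$ to the vertex $l_k$, is parametrized by $\overline{\Omega_k}=[0,L_k]$, $L_k>0$, and has diameter $D_k>0$, friction coefficient $\lambda_k\ge 0$ and inclination angle $\alpha_k\in(-\pi/2,\pi/2)$. Let $c,g>0$, $\beta_k=\lambda_k/(2D_k)$, $\gamma_k=g\sin(\alpha_k)/c^2$. Put $\xi_k(v)=-1$ if $v=0_k$, $\xi_k(v)=1$ if $v=l_k$, $\xi_k(v)=0$ otherwise. A vertex is *interior* if more than one pipe is incident to it; a non-interior vertex is an *entry* (*exit*) vertex if $\xi_k(v)=-1$ ($=+1$) for some $k$. Let $\mathbb L^2(\Omega)=\prod_{k=1}^m L^2(\Omega_k)\times L^2(\Omega_k)$ with $\|(p^k,q^k)_k\|^2=\sum_k D_k^2(\|p^k\|_{L^2}^2+c^2\|q^k\|_{L^2}^2)$, and let $\mathbb H^1(\Omega)$ be the corresponding product of $H^1$-spaces. Let $\mathbb A(p^k,q^k)_k=(-c^2\partial_xq^k,-\partial_xp^k)_k$,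 with domain $\mathcal D(\mathbb A)$ the set of all $(p^k,q^k)_k\in\mathbb H^1(\Omega)$ such that $p^k(0)=0$ if $0_k$ is an entry vertex, $q^k(L_k)=0$ if $l_k$ is an exit vertex, and at each interior vertex $v$ the values of the pressures $p^k$ of all incident pipes agree and $\sum_k\xi_k(v)D_k^2q^k(v)=0$ (*junction conditions*). Let $\mathbb P(p^k,q^k)_k=(0,-\gamma_kp^k)_k$, let $\mathbb P^*$ be its adjoint in $\mathbb L^2(\Omega)$, and let $\mathbb F(p^k,q^k)_k=(0,-\beta_kq^k|q^k|/p^k)_k$. For boundary values $\varphi=(\varphi^k_1,\varphi^k_2)_k\in\mathbb R^{2m}$ let $\mathbb B_0\varphi=(-\tfrac{c^2}{L_k}\varphi^k_2,\tfrac1{L_k}\varphi^k_1)_k$, $\mathbb B_1\varphi=(\tfrac{L_k-x}{L_k}\varphi^k_1,\tfrac{x}{L_k}\varphi^k_2)_k$, and for time-dependent $\Phi$ let $\mathbb B\Phi=\mathbb B_0\Phi+\mathbb P\mathbb B_1\Phi-\mathbb B_1\Phi_t$. *Steady state.* Let $p_{\rm in}^k,q_{\rm e}^k>0$, let $p_{\rm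 e}^k(x)=\sqrt{e^{-2\gamma_kx}\big[(p_{\rm in}^k)^2-\tfrac{\beta_k(q_{\rm e}^k)^2}{\gamma_k}(e^{2\gamma_kx}-1)\big]}$ (with its limit $\sqrt{(p_{\rm in}^k)^2-2\beta_k(q_{\rm e}^k)^2x}$ if $\gamma_k=0$) and $\mathbf v_{\rm e}=(p_{\rm e}^k,q_{\rm e}^k)_k$; assume that $p_{\rm e}^k(L_k)>0$ for all $k$ and that $\mathbf v_{\rm e}$ satisfies the junction conditions. A *suitable* set is a set $\mathcal K=\prod_k[a_k,b_k]\times[c_k,d_k]\subset\mathbb R^{2m}$ with $a_k>0$ and $a_k+p_{\rm in}^k\le b_k$ that contains $\mathbf v_{\rm e}(\mathbf x)=(p^k_{\rm e}(x_k),q^k_{\rm e})_k$ in its interior for all $\mathbf x\in\prod_k[0,L_k]$. *Controls.* Let $T>0$. $\mathbb U_0$ is the set of $\Phi=(\Phi^k_1,\Phi^k_2)_k\in H^2(0,T)^{2m}$ with $\Phi(0)=0$, $\Phi^k_1\equiv0$ if $0_k$ is not an entry vertex, and $\Phi^k_2\equiv0$ if $l_k$ is not an exit vertex. For $\eta,\kappa_{\mathbb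 U}>0$, $\mathbb U_0^\eta$ is the set of $\Phi\in\mathbb U_0$ with $\|\Phi\|_{H^2(0,T)^{2m}}\le\eta$ and $\|\Phi\|_{C([0,T])^{2m}}\le\kappa_{\mathbb U}$. Let $\Phi^{\rm e}\in\mathbb R^{2m}$ have the entry $p_{\rm in}^k$ for each $0_k$ that is an entry vertex, $q_{\rm e}^k$ for each $l_k$ that is an exit vertex, and $0$ otherwise. *State.* Let $\mathcal K$ be suitable, $\kappa_t,\kappa_{\mathbf x}>0$, and $\Phi\in\mathbb U_0^\eta$. Let $T$ be such that the state $\mathbb S(\Phi)$ exists on $[0,T]$; that is, $\mathbb S(\Phi)=\mathbf v=(p^k,q^k)_k\in C([0,T];\mathbb H^1(\Omega))\cap C^1([0,T];\mathbb L^2(\Omega))$ takes values in $\mathcal K$, satisfies $\|\mathbf v_t(t)\|_{\mathbb L^2}\le\kappa_t$ and $\|\partial_x\mathbf v(t)\|_{\mathbb L^2}\le\kappa_{\mathbf x}$ on $[0,T]$ and $\mathbf v(0)=\mathbf v_{\rm e}$, and, with $\tilde\Phi=\Phi+\Phi^{\rm e}$, $\mathbf u=\mathbf v-\mathbb B_1\tilde\Phi\in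 C([0,T];\mathcal D(\mathbb A))\cap C^1([0,T];\mathbb L^2(\Omega))$ solves $\mathbf u_t=(\mathbb A+\mathbb P)\mathbf u+\mathbb B\tilde\Phi+\mathbb F(\mathbf v)$ on $[0,T]$. Let $\mathfrak F(\tilde\Phi)(t)$ be the bounded operator on $\mathbb L^2(\Omega)$ of multiplication, on pipe $k$, by the matrix $\begin{pmatrix}0&0\\ \beta_k\,q^k|q^k|/(p^k)^2&-2\beta_k|q^k|/p^k\end{pmatrix}(t,\cdot)$, with adjoint $\mathfrak F(\tilde\Phi)^*$ in $\mathbb L^2(\Omega)$. Let $\mathbb K$ be suitable and let $\mathbf v_d$ be an interior point, in $C([0,T];\prod_kC([0,L_k])\times C([0,L_k]))$, of the set of functions with values in $\mathbb K$. Put $\mathbf g_\Phi(t,\mathbf p)=\mathfrak F(\tilde\Phi)(t)^*\mathbf p+\mathbb S(\Phi)(t)-\mathbf v_d(t)$ and, for $\mathbf h\in\mathbb U_0$, $\mathbf f_\Phi(\mathbf h)(t,\mathbf w)=\mathfrak F(\tilde\Phi)(t)\mathbf w+\big((\mathbb B+\mathfrak F(\tilde\Phi)\mathbb B_1)\mathbf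 h\big)(t)$. **Proposition.** There exists a unique mild solution $\mathbf p=\mathbf p_\Phi\in C([0,T];\mathbb L^2(\Omega))$ of the adjoint problem $$-\mathbf p_t=(-\mathbb A+\mathbb P^*)\mathbf p+\mathbf g_\Phi(t,\mathbf p),\qquad \mathbf p(T)=0,$$ that is, $-\mathbb A+\mathbb P^*$ (with domain $\mathcal D(\mathbb A)$) generates a $C_0$-semigroup $(S(t))_{t\ge0}$ on $\mathbb L^2(\Omega)$, and there is exactly one $\mathbf p\in C([0,T];\mathbb L^2(\Omega))$ with $\mathbf p(t)=\int_t^TS(s-t)\,\mathbf g_\Phi(s,\mathbf p(s))\,ds$ for all $t\in[0,T]$. Moreover, for each $\mathbf h\in\mathbb U_0$ the linearized problem $\mathbf w_t=(\mathbb A+\mathbb P)\mathbf w+\mathbf f_\Phi(\mathbf h)(t,\mathbf w)$, $\mathbf w(0)=0$, has a unique mild solution $\mathbf w\in C([0,T];\mathbb L^2(\Omega))$, and $$\int_0^T\big(\mathbf g_\Phi(t,\mathbf p(t)),\mathbf w(t)\big)_{\mathbb L^2(\Omega)}dt=\int_0^T\big(\mathbf p(t),\mathbf f_\Phi(\mathbf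 h)(t,\mathbf w(t))\big)_{\mathbb L^2(\Omega)}dt.$$ -/

import Mathlib

open Set Filter Topology MeasureTheory
open scoped NNReal ENNReal

noncomputable section

namespace GasNetwork

/-! ### One-dimensional Sobolev functions -/

/-- `f` is the continuous representative on `[a,b]` of an element of `H¹(a,b)` and `f'` is its weak
derivative: `f'` is square integrable and `f` is its antiderivative. -/
def IsH1On (a b : ℝ) (f f' : ℝ → ℝ) : Prop :=
  MemLp f' 2 (volume.restrict (Ioo a b)) ∧ ∀ x ∈ Icc a b, f x = f a + ∫ y in a..x, f' y

/-- An element of `H²(0,T)`: its `C¹` representative `val`, together with the continuous first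
derivative `d1` and the weak second derivative `d2`. -/
structure H2Fun (T : ℝ) where
  val : ℝ → ℝ
  d1 : ℝ → ℝ
  d2 : ℝ → ℝ
  val_mem : IsH1On 0 T val d1
  d1_mem : IsH1On 0 T d1 d2

/-- The square of the `H²(0,T)` norm. -/
def H2Fun.normSq {T : ℝ} (f : H2Fun T) : ℝ :=
  (∫ t in 0..T, f.val t ^ 2) + (∫ t in 0..T, f.d1 t ^ 2) + ∫ t in 0..T, f.d2 t ^ 2

/-! ### Strongly continuous semigroups and mild solutions -/

section Semigroup

variable {H : Type*} [NormedAddCommGroup H] [NormedSpace ℝ H]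

/-- A strongly continuous (`C₀`) semigroup of bounded operators; only times `t ≥ 0` matter. -/
structure C0Semigroup (H : Type*) [NormedAddCommGroup H] [NormedSpace ℝ H] where
  op : ℝ → H →L[ℝ] H
  op_zero : op 0 = ContinuousLinearMap.id ℝ H
  op_add : ∀ s t : ℝ, 0 ≤ s → 0 ≤ t → op (s + t) = (op s).comp (op t)
  tendsto_zero : ∀ x : H, Tendsto (fun t => op t x) (𝓝[>] 0) (𝓝 x)

/-- The operator with graph `{(x, y) | B x y}` is the infinitesimal generator of `S`
(equality of the operators, including their domains). -/
def C0Semigroup.IsGeneratedBy (S : C0Semigroup H) (B : H → H → Prop) : Prop :=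
  ∀ x y : H, B x y ↔ Tendsto (fun h : ℝ => h⁻¹ • (S.op h x - x)) (𝓝[>] 0) (𝓝 y)

/-- `w` is a mild solution on `[0,T]` of `w_t = B w + f(t, w)`, `w(0) = w₀`:
`B` generates a `C₀`-semigroup `S` and
`w(t) = S(t) w₀ + ∫₀ᵗ S(t - s) f(s, w(s)) ds`. -/
def IsMildForward (B : H → H → Prop) (T : ℝ) (f : ℝ → H → H) (w₀ : H) (w : ℝ → H) : Prop :=
  ∃ S : C0Semigroup H, S.IsGeneratedBy B ∧ ∀ t ∈ Icc 0 T,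
    IntervalIntegrable (fun s => S.op (t - s) (f s (w s))) volume 0 t ∧
    w t = S.op t w₀ + ∫ s in 0..t, S.op (t - s) (f s (w s))

/-- `p` is a mild solution on `[0,T]` of the backward problem `-p_t = B p + g(t, p)`,
`p(T) = p₁`: `B` generates a `C₀`-semigroup `S` and
`p(t) = S(T - t) p₁ + ∫ₜᵀ S(s - t) g(s, p(s)) ds`. -/
def IsMildBackward (B : H → H → Prop) (T : ℝ) (g : ℝ → H → H) (p₁ : H) (p : ℝ → H) : Prop :=
  ∃ S : C0Semigroup H, S.IsGeneratedBy B ∧ ∀ t ∈ Icc 0 T,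
    IntervalIntegrable (fun s => S.op (s - t) (g s (p s))) volume t T ∧
    p t = S.op (T - t) p₁ + ∫ s in t..T, S.op (s - t) (g s (p s))

end Semigroup

/-! ### Multiplication operators -/

/-- Multiplication by `a` maps `L²(μ)` boundedly to `L²(ν)`. -/
def MulBounded (μ ν : Measure ℝ) (a : ℝ → ℝ) : Prop :=
  MemLp a ⊤ ν ∧ ∃ C : ℝ≥0, ν ≤ C • μ

theorem MulBounded.exists_ae_le {μ ν : Measure ℝ} {a : ℝ → ℝ} (h : MulBounded μ ν a) :
    ∃ M : ℝ, 0 ≤ M ∧ ∀ᵐ x ∂ν, ‖a x‖ ≤ M := by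
  refine ⟨(eLpNorm a ⊤ ν).toReal, ENNReal.toReal_nonneg, ?_⟩
  have h1 : eLpNorm a ⊤ ν < ⊤ := h.1.2
  have h2 : ∀ᵐ x ∂ν, ‖a x‖ₑ ≤ eLpNorm a ⊤ ν := by
    rw [eLpNorm_exponent_top]
    exact enorm_ae_le_eLpNormEssSup a ν
  filter_upwards [h2] with x hx
  have := ENNReal.toReal_mono h1.ne hx
  simpa using this

theorem MulBounded.memLp_of_memLp {μ ν : Measure ℝ} {a f : ℝ → ℝ} (h : MulBounded μ ν a)
    (hf : MemLp f 2 μ) : MemLp f 2 ν := by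
  obtain ⟨C, hC⟩ := h.2
  exact (hf.smul_measure (c := (C : ℝ≥0∞)) ENNReal.coe_ne_top).mono_measure hC

theorem MulBounded.memLp {μ ν : Measure ℝ} {a f : ℝ → ℝ} (h : MulBounded μ ν a)
    (hf : MemLp f 2 μ) : MemLp (fun x => a x * f x) 2 ν :=
  MemLp.mul (p := ⊤) (q := 2) (h.memLp_of_memLp hf) h.1

theorem MulBounded.ac {μ ν : Measure ℝ} {a : ℝ → ℝ} (h : MulBounded μ ν a) : ν ≪ μ := by
  obtain ⟨C, hC⟩ := h.2
  exact (Measure.absolutelyContinuous_of_le hC).trans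
    (Measure.smul_absolutelyContinuous (c := (C : ℝ≥0∞)))

open Classical in
/-- The bounded operator `f ↦ a f` from `L²(μ)` to `L²(ν)` (zero if it is not bounded). -/
def mulOp (μ ν : Measure ℝ) (a : ℝ → ℝ) : Lp ℝ 2 μ →L[ℝ] Lp ℝ 2 ν :=
  if h : MulBounded μ ν a then
    LinearMap.mkContinuousOfExistsBound
      { toFun := fun f => (h.memLp (Lp.memLp f)).toLp
        map_add' := by
          intro f g
          rw [← MemLp.toLp_add, MemLp.toLp_eq_toLp_iff]
          filter_upwards [h.ac.ae_le (Lp.coeFn_add f g)] with x hx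
          change a x * (f + g : Lp ℝ 2 μ) x = a x * f x + a x * g x
          rw [hx, Pi.add_apply, mul_add]
        map_smul' := by
          intro r f
          rw [RingHom.id_apply, ← MemLp.toLp_const_smul, MemLp.toLp_eq_toLp_iff]
          filter_upwards [h.ac.ae_le (Lp.coeFn_smul r f)] with x hx
          change a x * (r • f : Lp ℝ 2 μ) x = r • (a x * f x)
          rw [hx, Pi.smul_apply, smul_eq_mul, smul_eq_mul, mul_left_comm] }
      (by
        obtain ⟨M, hM0, hM⟩ := h.exists_ae_le
        obtain ⟨C, hC⟩ := h.2
        refine ⟨M * (((C : ℝ≥0∞) ^ (1 / (2 : ℝ≥0∞)).toReal).toReal), fun f => ?_⟩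
        have hfin : eLpNorm f 2 μ ≠ ⊤ := (Lp.memLp f).2.ne
        have hCf : (C : ℝ≥0∞) ^ (1 / (2 : ℝ≥0∞)).toReal ≠ ⊤ :=
          ENNReal.rpow_ne_top_of_nonneg ENNReal.toReal_nonneg ENNReal.coe_ne_top
        have e1 : eLpNorm (fun x => a x * f x) 2 ν ≤ ENNReal.ofReal M * eLpNorm f 2 ν := by
          refine eLpNorm_le_mul_eLpNorm_of_ae_le_mul (c := M) ?_ 2
          filter_upwards [hM] with x hx
          rw [norm_mul]
          exact mul_le_mul_of_nonneg_right hx (norm_nonneg _)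
        have e2 : eLpNorm f 2 ν ≤ (C : ℝ≥0∞) ^ (1 / (2 : ℝ≥0∞)).toReal * eLpNorm f 2 μ := by
          refine (eLpNorm_mono_measure f hC).trans (le_of_eq ?_)
          exact eLpNorm_smul_measure_of_ne_top (by norm_num) f (C : ℝ≥0∞)
        show ‖(h.memLp (Lp.memLp f)).toLp‖ ≤ _
        rw [Lp.norm_toLp, Lp.norm_def, mul_assoc, ← ENNReal.toReal_mul]
        refine (ENNReal.toReal_mono (ENNReal.mul_ne_top ENNReal.ofReal_ne_top
          (ENNReal.mul_ne_top hCf hfin)) (e1.trans (mul_le_mul_right e2 _))).trans (le_of_eq ?_)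
        rw [ENNReal.toReal_mul, ENNReal.toReal_ofReal hM0])
  else 0

theorem mulOp_coeFn {μ ν : Measure ℝ} {a : ℝ → ℝ} (h : MulBounded μ ν a) (f : Lp ℝ 2 μ) :
    mulOp μ ν a f =ᵐ[ν] fun x => a x * f x := by
  have : mulOp μ ν a f = (h.memLp (Lp.memLp f)).toLp := by
    rw [mulOp, dif_pos h]; rfl
  rw [this]
  exact MemLp.coeFn_toLp _

/-! ### The network -/

/-- A network of `m` pipes and `n` vertices: a finite directed graph whose underlying undirected
graph is a tree, with the physical data of the pipes. Pipe `k` runs from `src k` to `tgt k` and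
is parametrized by `[0, L k]`. -/
structure Network (m n : ℕ) where
  src : Fin m → Fin n
  tgt : Fin m → Fin n
  no_loop : ∀ k, src k ≠ tgt k
  no_parallel : Function.Injective fun k => s(src k, tgt k)
  isTree : (SimpleGraph.fromRel fun a b => ∃ k, src k = a ∧ tgt k = b).IsTree
  /-- speed of sound -/
  c : ℝ
  c_pos : 0 < c
  /-- acceleration of gravity -/
  g : ℝ
  g_pos : 0 < g
  /-- lengths -/
  L : Fin m → ℝ
  L_pos : ∀ k, 0 < L k
  /-- diameters -/
  D : Fin m → ℝ
  D_pos : ∀ k, 0 < D k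
  /-- friction coefficients -/
  lam : Fin m → ℝ
  lam_nonneg : ∀ k, 0 ≤ lam k
  /-- inclination angles -/
  α : Fin m → ℝ
  α_mem : ∀ k, α k ∈ Ioo (-(Real.pi / 2)) (Real.pi / 2)

/-- A family of functions on the pipes: `w k 0` is the pressure component and `w k 1` the flux
component on pipe `k`. -/
abbrev Field (m : ℕ) := Fin m → Fin 2 → ℝ → ℝ

/-- Boundary controls: `Φ k 0` acts on the pressure at the start of pipe `k`, `Φ k 1` on the flux
at its end. -/
abbrev Control (m : ℕ) (T : ℝ) := Fin m → Fin 2 → H2Fun T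

namespace Network

variable {m n : ℕ} (N : Network m n)

def β (k : Fin m) : ℝ := N.lam k / (2 * N.D k)

def γ (k : Fin m) : ℝ := N.g * Real.sin (N.α k) / N.c ^ 2

/-- The incidence function `ξ_k(v)`. -/
def ξ (k : Fin m) (v : Fin n) : ℝ :=
  if v = N.src k then -1 else if v = N.tgt k then 1 else 0

/-- Interior nodes (junctions): more than one pipe is incident. -/
def interiorNodes : Set (Fin n) := {v | 1 < {k | N.ξ k v ≠ 0}.ncard}

/-- Entry vertices. -/
def entryNodes : Set (Fin n) := {v | v ∉ N.interiorNodes ∧ ∃ k, N.ξ k v = -1}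

/-- Exit vertices. -/
def exitNodes : Set (Fin n) := {v | v ∉ N.interiorNodes ∧ ∃ k, N.ξ k v = 1}

/-- The value of a function on pipe `k` at the end point of the pipe that sits at `v`. -/
def atVertex (k : Fin m) (v : Fin n) (f : ℝ → ℝ) : ℝ := if v = N.src k then f 0 else f (N.L k)

/-- Continuity of the pressure at the junctions. -/
def PressureContinuous (w : Field m) : Prop :=
  ∀ v ∈ N.interiorNodes, ∀ j k, N.ξ j v ≠ 0 → N.ξ k v ≠ 0 →
    N.atVertex j v (w j 0) = N.atVertex k v (w k 0)

/-- The Kirchhoff condition at the junctions. -/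
def Kirchhoff (w : Field m) : Prop :=
  ∀ v ∈ N.interiorNodes, ∑ k, N.ξ k v * N.D k ^ 2 * N.atVertex k v (w k 1) = 0

/-! ### The space `𝕃²(Ω)` -/

/-- Lebesgue measure on pipe `k` with the weight `D_k²` (pressure) or `c² D_k²` (flux). -/
def μ (j : Fin m × Fin 2) : Measure ℝ :=
  ENNReal.ofReal (N.D j.1 ^ 2 * if j.2 = 0 then 1 else N.c ^ 2) •
    volume.restrict (Ioo 0 (N.L j.1))

/-- The Hilbert space `𝕃²(Ω)` with norm `∑ₖ D_k² (‖w_{k,0}‖² + c² ‖w_{k,1}‖²)` (squared). -/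
abbrev L2 : Type := PiLp 2 fun j : Fin m × Fin 2 => Lp ℝ 2 (N.μ j)

open Classical in
/-- The element of `𝕃²(Ω)` given by a square integrable field (components that are not square
integrable are replaced by `0`). -/
def toL2 (w : Field m) : N.L2 :=
  WithLp.toLp 2 fun j => if h : MemLp (w j.1 j.2) 2 (N.μ j) then h.toLp else 0

/-- The operator on `𝕃²(Ω)` of multiplication by `2 × 2` matrices of functions on each pipe:
`(M u)_{k,i} = ∑ⱼ M k i j * u_{k,j}`. -/
def matrixOp (M : Fin m → Fin 2 → Fin 2 → ℝ → ℝ) : N.L2 →L[ℝ] N.L2 :=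
  (PiLp.continuousLinearEquiv 2 ℝ fun j : Fin m × Fin 2 => Lp ℝ 2 (N.μ j)).symm.toContinuousLinearMap.comp
    (ContinuousLinearMap.pi fun j =>
      ∑ l : Fin 2, (mulOp (N.μ (j.1, l)) (N.μ j) (M j.1 j.2 l)).comp
        (PiLp.proj 2 (fun j : Fin m × Fin 2 => Lp ℝ 2 (N.μ j)) (j.1, l)))

/-! ### The operators of the abstract system -/

/-- The graph of `𝔸`: `u ∈ 𝒟(𝔸)` and `𝔸 u = z`. Here `w` is the `ℍ¹(Ω)` representative of `u`, and
`𝔸 (p, q) = (-c² ∂ₓ q, -∂ₓ p)` on every pipe. -/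
def opA (u z : N.L2) : Prop :=
  ∃ w w' : Field m,
    (∀ k i, IsH1On 0 (N.L k) (w k i) (w' k i)) ∧
    (∀ k i, u (k, i) =ᵐ[N.μ (k, i)] w k i) ∧
    (∀ k, N.src k ∈ N.entryNodes → w k 0 0 = 0) ∧
    (∀ k, N.tgt k ∈ N.exitNodes → w k 1 (N.L k) = 0) ∧
    N.PressureContinuous w ∧ N.Kirchhoff w ∧
    ∀ k, (z (k, 0) =ᵐ[N.μ (k, 0)] fun x => -N.c ^ 2 * w' k 1 x) ∧
      (z (k, 1) =ᵐ[N.μ (k, 1)] fun x => -w' k 0 x)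

/-- The bounded operator `ℙ (p, q) = (0, -γ_k p)`. -/
def opP : N.L2 →L[ℝ] N.L2 :=
  N.matrixOp fun k => ![![0, 0], ![fun _ => -N.γ k, 0]]

/-- The graph of `𝔸 + ℙ`. -/
def opForward (u z : N.L2) : Prop := ∃ y, N.opA u y ∧ z = y + N.opP u

/-- The graph of `-𝔸 + ℙ*`. -/
def opAdjoint (u z : N.L2) : Prop :=
  ∃ y, N.opA u y ∧ z = -y + ContinuousLinearMap.adjoint N.opP u

/-- `𝔹₀ φ` for boundary values `φ`. -/
def B0 (φ : Fin m → Fin 2 → ℝ) : Field m := fun k =>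
  ![fun _ => -(N.c ^ 2 / N.L k) * φ k 1, fun _ => 1 / N.L k * φ k 0]

/-- `𝔹₁ φ` for boundary values `φ`. -/
def B1 (φ : Fin m → Fin 2 → ℝ) : Field m := fun k =>
  ![fun x => (N.L k - x) / N.L k * φ k 0, fun x => x / N.L k * φ k 1]

/-- `𝔹 Φ = 𝔹₀ Φ + ℙ 𝔹₁ Φ - 𝔹₁ Φ_t` at a time at which `Φ = φ` and `Φ_t = φ'`. -/
def opB (φ φ' : Fin m → Fin 2 → ℝ) : N.L2 :=
  N.toL2 (N.B0 φ) + N.opP (N.toL2 (N.B1 φ)) - N.toL2 (N.B1 φ')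

/-- The nonlinearity `𝔽 (p, q) = (0, -β_k q|q|/p)`. -/
def nonlinearF (w : Field m) : Field m := fun k =>
  ![0, fun x => -N.β k * (w k 1 x * |w k 1 x| / w k 0 x)]

/-- The operator `𝔉` of multiplication by the derivative of `𝔽` at `w = (p, q)`. -/
def frakF (w : Field m) : N.L2 →L[ℝ] N.L2 :=
  N.matrixOp fun k => ![![0, 0],
    ![fun x => N.β k * (w k 1 x * |w k 1 x| / w k 0 x ^ 2),
      fun x => -2 * N.β k * (|w k 1 x| / w k 0 x)]]

/-! ### The steady state -/

/-- The steady state pressure with inlet pressures `pin` and fluxes `qe`. For `γ_k = 0` the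
formula is replaced by its limit. -/
def steadyPressure (pin qe : Fin m → ℝ) (k : Fin m) (x : ℝ) : ℝ :=
  if N.γ k = 0 then √(pin k ^ 2 - 2 * N.β k * qe k ^ 2 * x)
  else √(Real.exp (-2 * N.γ k * x) *
    (pin k ^ 2 - N.β k * qe k ^ 2 / N.γ k * (Real.exp (2 * N.γ k * x) - 1)))

/-- The steady state `v_e`. -/
def steadyState (pin qe : Fin m → ℝ) : Field m := fun k =>
  ![N.steadyPressure pin qe k, fun _ => qe k]

/-- The standing assumption on the steady state: positive fluxes and inlet and outlet pressures,
and compatibility with the conditions at the junctions. -/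
structure IsSteadyData (pin qe : Fin m → ℝ) : Prop where
  flux_pos : ∀ k, 0 < qe k
  in_pos : ∀ k, 0 < pin k
  out_pos : ∀ k, 0 < N.steadyPressure pin qe k (N.L k)
  pressure : N.PressureContinuous (N.steadyState pin qe)
  kirchhoff : N.Kirchhoff (N.steadyState pin qe)

open Classical in
/-- The constant boundary values `Φᵉ` of the steady state. -/
def steadyControl (pin qe : Fin m → ℝ) : Fin m → Fin 2 → ℝ := fun k =>
  ![if N.src k ∈ N.entryNodes then pin k else 0, if N.tgt k ∈ N.exitNodes then qe k else 0]

/-- Suitable compact sets `K = ∏ₖ [a_k, b_k] × [c_k, d_k] ⊆ ℝ^{2m}`. -/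
def IsSuitable (pin qe : Fin m → ℝ) (K : Set (Fin m → Fin 2 → ℝ)) : Prop :=
  (∃ a b c d : Fin m → ℝ, (∀ k, 0 < a k) ∧ (∀ k, a k + pin k ≤ b k) ∧
    K = {z | ∀ k, z k 0 ∈ Icc (a k) (b k) ∧ z k 1 ∈ Icc (c k) (d k)}) ∧
  ∀ x : Fin m → ℝ, (∀ k, x k ∈ Icc 0 (N.L k)) →
    (fun k i => N.steadyState pin qe k i (x k)) ∈ interior K

/-! ### Controls -/

/-- The space `𝕌`: controls act only at entry vertices (pressure) and exit vertices (flux). -/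
def MemU {T : ℝ} (Φ : Control m T) : Prop :=
  ∀ k, (N.src k ∉ N.entryNodes → ∀ t ∈ Icc 0 T, (Φ k 0).val t = 0) ∧
    (N.tgt k ∉ N.exitNodes → ∀ t ∈ Icc 0 T, (Φ k 1).val t = 0)

/-- The space `𝕌₀`. -/
def MemU0 {T : ℝ} (Φ : Control m T) : Prop :=
  N.MemU Φ ∧ ∀ k i, (Φ k i).val 0 = 0

/-- The set `𝕌₀^η`. -/
def MemU0eta {T : ℝ} (η κU : ℝ) (Φ : Control m T) : Prop :=
  N.MemU0 Φ ∧ ∑ k, ∑ i, (Φ k i).normSq ≤ η ^ 2 ∧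
    ∀ k i, ∀ t ∈ Icc 0 T, |(Φ k i).val t| ≤ κU

/-! ### The state system -/

/-- The space `𝕍_T = C([0,T]; ∏ₖ C[0, L_k] × C[0, L_k])`. -/
abbrev VT (T : ℝ) : Type :=
  C(Icc (0 : ℝ) T, (k : Fin m) → Fin 2 → C(Icc (0 : ℝ) (N.L k), ℝ))

/-- The functions on the pipes given by `v` at time `t ∈ [0,T]` (extended by constants outside the
intervals). -/
def fieldAt {T : ℝ} (hT : 0 < T) (v : N.VT T) (t : ℝ) : Field m := fun k i =>
  IccExtend (N.L_pos k).le (v (projIcc 0 T hT.le t) k i)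

/-- The admissible set `𝕍_{T,K}^{ad}`. -/
def Vad (T : ℝ) (K : Set (Fin m → Fin 2 → ℝ)) : Set (N.VT T) :=
  {v | ∀ t, ∀ x : (k : Fin m) → Icc (0 : ℝ) (N.L k), (fun k i => v t k i (x k)) ∈ K}

/-- `v` belongs to `X_T^K(ℍ¹(Ω), 𝕃²(Ω))`; `Vt` and `Vx` are the time and space derivatives. -/
def MemXK {T : ℝ} (hT : 0 < T) (K : Set (Fin m → Fin 2 → ℝ)) (κt κx : ℝ) (v : N.VT T) : Prop :=
  v ∈ N.Vad T K ∧ ∃ Vt Vx : ℝ → N.L2,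
    ContinuousOn Vt (Icc 0 T) ∧ ContinuousOn Vx (Icc 0 T) ∧
    ∀ t ∈ Icc 0 T,
      HasDerivWithinAt (fun s => N.toL2 (N.fieldAt hT v s)) (Vt t) (Icc 0 T) t ∧
      (∀ k i, IsH1On 0 (N.L k) (N.fieldAt hT v t k i) (Vx t (k, i))) ∧
      ‖Vt t‖ ≤ κt ∧ ‖Vx t‖ ≤ κx

/-- `u = v - 𝔹₁ φ` is a classical solution, in `C([0,T]; 𝒟(𝔸)) ∩ C¹([0,T]; 𝕃²(Ω))`, of
`u_t = (𝔸 + ℙ) u + 𝔹 φ + 𝔽(v)` with `v(0) = v_e`; here `φ` is the boundary datum with time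
derivative `φ'`. -/
def IsClassicalState (pin qe : Fin m → ℝ) {T : ℝ} (hT : 0 < T)
    (φ φ' : ℝ → Fin m → Fin 2 → ℝ) (v : N.VT T) : Prop :=
  (∀ k i, ∀ x ∈ Icc 0 (N.L k), N.fieldAt hT v 0 k i x = N.steadyState pin qe k i x) ∧
  ∃ u ut Au : ℝ → N.L2,
    (∀ t ∈ Icc 0 T, u t = N.toL2 (N.fieldAt hT v t) - N.toL2 (N.B1 (φ t))) ∧
    ContinuousOn ut (Icc 0 T) ∧ ContinuousOn Au (Icc 0 T) ∧
    ∀ t ∈ Icc 0 T, HasDerivWithinAt u (ut t) (Icc 0 T) t ∧ N.opA (u t) (Au t) ∧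
      ut t = Au t + N.opP (u t) + N.opB (φ t) (φ' t) + N.toL2 (N.nonlinearF (N.fieldAt hT v t))

/-- `v = 𝕊(Φ)`: the element of `X_T^K` that is the classical state for the boundary datum
`Φ + Φᵉ`. -/
def IsStateOf (pin qe : Fin m → ℝ) {T : ℝ} (hT : 0 < T) (K : Set (Fin m → Fin 2 → ℝ))
    (κt κx : ℝ) (Φ : Control m T) (v : N.VT T) : Prop :=
  N.MemXK hT K κt κx v ∧
    N.IsClassicalState pin qe hT (fun t k i => (Φ k i).val t + N.steadyControl pin qe k i)
      (fun t k i => (Φ k i).d1 t) v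

/-! ### The adjoint and the linearized problem -/

/-- `g_Φ(t, p) = 𝔉(Φ̃)* p + 𝕊(Φ) - v_d`, where `v = 𝕊(Φ)`. -/
def adjointRhs {T : ℝ} (hT : 0 < T) (v vd : N.VT T) (t : ℝ) (p : N.L2) : N.L2 :=
  ContinuousLinearMap.adjoint (N.frakF (N.fieldAt hT v t)) p
    + N.toL2 (N.fieldAt hT v t) - N.toL2 (N.fieldAt hT vd t)

/-- `f_Φ(h)(t, w) = 𝔉(Φ̃) w + (𝔹 + 𝔉(Φ̃) 𝔹₁) h`, where `v = 𝕊(Φ)`. -/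
def linearizedRhs {T : ℝ} (hT : 0 < T) (v : N.VT T) (h : Control m T) (t : ℝ) (w : N.L2) :
    N.L2 :=
  N.frakF (N.fieldAt hT v t) w
    + (N.opB (fun k i => (h k i).val t) (fun k i => (h k i).d1 t)
      + N.frakF (N.fieldAt hT v t) (N.toL2 (N.B1 fun k i => (h k i).val t)))

/-- `p` is a mild solution of `-p_t = (-𝔸 + ℙ*) p + g_Φ(t, p)`, `p(T) = 0`. -/
def IsAdjointState {T : ℝ} (hT : 0 < T) (v vd : N.VT T) (p : C(Icc (0 : ℝ) T, N.L2)) : Prop :=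
  IsMildBackward N.opAdjoint T (N.adjointRhs hT v vd) 0 (IccExtend hT.le p)

/-- `w` is a mild solution of `w_t = (𝔸 + ℙ) w + f_Φ(h)(t, w)`, `w(0) = 0`. -/
def IsLinearizedState {T : ℝ} (hT : 0 < T) (v : N.VT T) (h : Control m T)
    (w : C(Icc (0 : ℝ) T, N.L2)) : Prop :=
  IsMildForward N.opForward T (N.linearizedRhs hT v h) 0 (IccExtend hT.le w)

end Network

end GasNetwork

end

/-! The theorem rests on one structural fact: `𝔸` is skew-adjoint on the weighted space. Integration
by parts on every pipe gives Green's formula, whose boundary terms can be regrouped vertex by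
vertex. The vertex conditions are exactly their own annihilator under this boundary form: junction
pressures are common factors multiplying a vanishing flux balance, while at an entry or exit one
factor of each product vanishes. Conversely, testing with fields supported on one pipe recovers weak
derivatives, and testing with linear interpolations recovers every vertex condition
(`isSkewAdjointGraph_opA`).

A skew-adjoint operator plus a bounded one generates a `C₀`-semigroup. Subtracting `‖P‖` makes the
sum dissipative, the range condition is `exists_resolvent`, and Lumer-Phillips applies through
Yosida approximations (`exists_c0Semigroup_of_dissipative`). This covers both `𝔸 + ℙ` and `-𝔸 + ℙ*`.
These operators are formally adjoint and densely defined, so their semigroups are adjoint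
(`C0Semigroup.inner_op_eq`). The same duality shows that each generator determines its semigroup, so
a mild solution does not depend on the semigroup chosen in its definition.

State values lie in a compact box with positive pressures. Hence `𝔉` depends continuously on time in
operator norm, and both right hand sides are affine in the unknown with continuous coefficients. A
Volterra fixed point argument gives existence and uniqueness forward in time, and time reversal
gives the adjoint problem.

For the identity, insert the two Duhamel formulas. Both sides become the integral of `⟨g(t), S(t -
s) f(s)⟩` over the triangle `s ≤ t`, by adjointness of the semigroups and Fubini
(`integral_inner_mild_eq`). -/

noncomputable section

namespace GasNetwork

/-! ### Bounds, joint continuity and one-sided derivatives of `C₀`-semigroups -/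

section Semigroup

namespace C0Semigroup

variable {H : Type*} [NormedAddCommGroup H] [NormedSpace ℝ H]

theorem tendsto_nhdsGE_zero (S : C0Semigroup H) (x : H) :
    Tendsto (fun t => S.op t x) (𝓝[≥] 0) (𝓝 x) := by
  rw [← Ioi_insert, nhdsWithin_insert]
  refine Tendsto.sup ?_ (S.tendsto_zero x)
  rw [tendsto_pure_left]
  intro s hs
  have := mem_of_mem_nhds hs
  simpa [S.op_zero] using this

/-- The domain of the generator is invariant, and the generator commutes with the semigroup. -/
theorem tendsto_quotient_op (S : C0Semigroup H) {x y : H}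
    (hxy : Tendsto (fun h : ℝ => h⁻¹ • (S.op h x - x)) (𝓝[>] 0) (𝓝 y)) {s : ℝ} (hs : 0 ≤ s) :
    Tendsto (fun h : ℝ => h⁻¹ • (S.op h (S.op s x) - S.op s x)) (𝓝[>] 0) (𝓝 (S.op s y)) := by
  refine (((S.op s).continuous.tendsto y).comp hxy).congr' ?_
  filter_upwards [self_mem_nhdsWithin] with h hh
  have e : (S.op h) (S.op s x) = S.op s (S.op h x) := by
    rw [← ContinuousLinearMap.comp_apply, ← ContinuousLinearMap.comp_apply,
      ← S.op_add h s (le_of_lt hh) hs, add_comm h s, S.op_add s h hs (le_of_lt hh)]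
  simp [map_sub, e]

variable [CompleteSpace H]

/-- Otherwise some `t n → 0` has `‖S.op (t n)‖ > n`. Each orbit converges along `t n`, hence is
bounded, which contradicts Banach-Steinhaus. -/
theorem exists_bound_near_zero (S : C0Semigroup H) :
    ∃ δ > 0, ∃ M, ∀ t ∈ Icc 0 δ, ‖S.op t‖ ≤ M := by
  by_contra! hcon
  choose t ht hlt using fun n : ℕ => hcon (1 / ((n : ℝ) + 1)) (by positivity) n
  have htend : Tendsto t atTop (𝓝[≥] 0) := by
    refine tendsto_nhdsWithin_iff.2 ⟨?_, Eventually.of_forall fun n => (ht n).1⟩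
    exact squeeze_zero (fun n => (ht n).1) (fun n => (ht n).2)
      tendsto_one_div_add_atTop_nhds_zero_nat
  obtain ⟨C, hC⟩ := banach_steinhaus (g := fun n => S.op (t n)) fun x => by
    obtain ⟨C, hC⟩ := ((S.tendsto_nhdsGE_zero x).comp htend).norm.bddAbove_range
    exact ⟨C, fun n => hC ⟨n, rfl⟩⟩
  obtain ⟨n, hn⟩ := exists_nat_gt C
  exact absurd (hC n) (not_le.2 (hn.trans (hlt n)))

/-- The bound near zero propagates through the semigroup law, each further step of length `δ`
costing a factor `M`. -/
theorem exists_bound (S : C0Semigroup H) (T : ℝ) :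
    ∃ M, 0 ≤ M ∧ ∀ t ∈ Icc 0 T, ‖S.op t‖ ≤ M := by
  obtain ⟨δ, hδ, M, hM⟩ := S.exists_bound_near_zero
  have hM0 : 0 ≤ M := (norm_nonneg _).trans (hM 0 ⟨le_rfl, hδ.le⟩)
  have key : ∀ n : ℕ, ∃ C, 0 ≤ C ∧ ∀ t ∈ Icc 0 (n * δ), ‖S.op t‖ ≤ C := by
    intro n
    induction n with
    | zero =>
      refine ⟨M, hM0, fun t ht => hM t ⟨ht.1, ht.2.trans ?_⟩⟩
      simpa using hδ.le
    | succ n ih =>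
      obtain ⟨C, hC0, hC⟩ := ih
      refine ⟨max M (M * C), le_max_of_le_left hM0, fun t ht => ?_⟩
      rcases le_total t δ with h | h
      · exact (hM t ⟨ht.1, h⟩).trans (le_max_left _ _)
      · have e : S.op t = (S.op δ).comp (S.op (t - δ)) := by
          rw [← S.op_add δ (t - δ) hδ.le (by linarith)]; congr 1; ring
        have h2 : t ≤ (n + 1) * δ := by simpa using ht.2
        rw [e]
        refine ((S.op δ).opNorm_comp_le _).trans (le_max_of_le_right ?_)
        exact mul_le_mul (hM δ ⟨hδ.le, le_rfl⟩) (hC _ ⟨by linarith, by linarith⟩)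
          (norm_nonneg _) hM0
  obtain ⟨n, hn⟩ := exists_nat_ge (T / δ)
  obtain ⟨C, hC0, hC⟩ := key n
  exact ⟨C, hC0, fun t ht => hC t ⟨ht.1, ht.2.trans ((div_le_iff₀ hδ).1 hn)⟩⟩

omit [CompleteSpace H] in
-- Factoring out the operator at the smaller time reduces continuity of an orbit at any time to
-- continuity at zero, from both sides at once.
theorem norm_sub_le (S : C0Semigroup H) {T M : ℝ} (hM : ∀ t ∈ Icc 0 T, ‖S.op t‖ ≤ M)
    {s t : ℝ} (hs : s ∈ Icc 0 T) (ht : t ∈ Icc 0 T) (x : H) :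
    ‖S.op t x - S.op s x‖ ≤ M * ‖S.op |t - s| x - x‖ := by
  wlog hst : s ≤ t generalizing s t
  · rw [norm_sub_rev, abs_sub_comm]
    exact this ht hs (le_of_not_ge hst)
  have e : S.op t = (S.op s).comp (S.op (t - s)) := by
    rw [← S.op_add s (t - s) hs.1 (by linarith)]; congr 1; ring
  rw [e, abs_of_nonneg (by linarith), ContinuousLinearMap.comp_apply, ← map_sub]
  exact (S.op s).le_of_opNorm_le (hM s hs) _

theorem continuousOn_op (S : C0Semigroup H) (x : H) :
    ContinuousOn (fun t => S.op t x) (Ici 0) := by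
  intro t ht
  obtain ⟨M, hM0, hM⟩ := S.exists_bound (t + 1)
  refine tendsto_iff_norm_sub_tendsto_zero.2 ?_
  have h1 : Tendsto (fun s => |s - t|) (𝓝[Ici 0] t) (𝓝[≥] 0) := by
    refine tendsto_nhdsWithin_iff.2 ⟨?_, Eventually.of_forall fun n => mem_Ici.2 (abs_nonneg _)⟩
    have : Tendsto (fun s => |s - t|) (𝓝 t) (𝓝 |t - t|) :=
      (continuous_abs.comp (continuous_id.sub continuous_const)).tendsto t
    simpa using this.mono_left nhdsWithin_le_nhds
  have h2 := (((S.tendsto_nhdsGE_zero x).comp h1).sub_const x).norm.const_mul M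
  simp only [sub_self, norm_zero, mul_zero] at h2
  refine squeeze_zero' (Eventually.of_forall fun _ => norm_nonneg _) ?_ h2
  filter_upwards [self_mem_nhdsWithin, nhdsWithin_le_nhds (Iio_mem_nhds (lt_add_one t))]
    with s hs0 hs1
  exact S.norm_sub_le hM ⟨ht, by linarith⟩ ⟨hs0, le_of_lt hs1⟩ x

/-- A strongly continuous semigroup, extended by the identity to negative times, is jointly
continuous. -/
theorem continuous_op_max (S : C0Semigroup H) :
    Continuous fun p : ℝ × H => S.op (max p.1 0) p.2 := by
  rw [continuous_iff_continuousAt]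
  rintro ⟨t, x⟩
  obtain ⟨M, hM0, hM⟩ := S.exists_bound (max t 0 + 1)
  have h1 : Continuous fun s : ℝ => S.op (max s 0) x :=
    (S.continuousOn_op x).comp_continuous (by fun_prop) fun s => le_max_right s 0
  have h2 : Tendsto (fun p : ℝ × H => S.op (max p.1 0) x) (𝓝 (t, x)) (𝓝 (S.op (max t 0) x)) :=
    (h1.comp continuous_fst).tendsto (t, x)
  have h3 : Tendsto (fun p : ℝ × H => S.op (max p.1 0) (p.2 - x)) (𝓝 (t, x)) (𝓝 0) := by
    have h4 : Tendsto (fun p : ℝ × H => M * ‖p.2 - x‖) (𝓝 (t, x)) (𝓝 0) := by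
      have : Continuous fun p : ℝ × H => M * ‖p.2 - x‖ := by fun_prop
      simpa using this.tendsto (t, x)
    refine squeeze_zero_norm' ?_ h4
    have h5 : ∀ᶠ p : ℝ × H in 𝓝 (t, x), max p.1 0 < max t 0 + 1 := by
      have : Continuous fun p : ℝ × H => max p.1 0 := by fun_prop
      exact this.tendsto (t, x) (Iio_mem_nhds (lt_add_one (max t 0)))
    filter_upwards [h5] with p hp
    exact (S.op _).le_of_opNorm_le (hM _ ⟨le_max_right _ _, hp.le⟩) _
  have h6 := h3.add h2
  simp only [zero_add, ← map_add, sub_add_cancel] at h6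
  exact h6

omit [CompleteSpace H] in
theorem hasDerivWithinAt_Ici (S : C0Semigroup H) {x y : H}
    (hxy : Tendsto (fun h : ℝ => h⁻¹ • (S.op h x - x)) (𝓝[>] 0) (𝓝 y)) {t : ℝ} (ht : 0 ≤ t) :
    HasDerivWithinAt (fun s => S.op s x) (S.op t y) (Ici t) t := by
  rw [← hasDerivWithinAt_Ioi_iff_Ici, hasDerivWithinAt_iff_tendsto_slope' (by simp)]
  have h1 : Tendsto (fun s => s - t) (𝓝[>] t) (𝓝[>] 0) := by
    refine tendsto_nhdsWithin_iff.2 ⟨?_, ?_⟩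
    · have : Tendsto (fun s => s - t) (𝓝 t) (𝓝 (t - t)) :=
        (continuous_id.sub continuous_const).tendsto t
      simpa using this.mono_left nhdsWithin_le_nhds
    · filter_upwards [self_mem_nhdsWithin] with s hs
      exact mem_Ioi.2 (sub_pos.2 hs)
  refine (((S.op t).continuous.tendsto y).comp (hxy.comp h1)).congr' ?_
  filter_upwards [self_mem_nhdsWithin] with s hs
  have e : S.op s = (S.op t).comp (S.op (s - t)) := by
    rw [← S.op_add t (s - t) ht (sub_nonneg.2 (le_of_lt hs))]; congr 1; ring
  simp [slope, e, map_sub]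

/-- From the left, the quotient is `S.op s` applied to the quotient at zero with step `t - s`.
Operator and vector both vary with `s`, so joint continuity is needed, unlike on the right. -/
theorem hasDerivWithinAt_Iic (S : C0Semigroup H) {x y : H}
    (hxy : Tendsto (fun h : ℝ => h⁻¹ • (S.op h x - x)) (𝓝[>] 0) (𝓝 y)) {t : ℝ} (ht : 0 < t) :
    HasDerivWithinAt (fun s => S.op (max s 0) x) (S.op t y) (Iic t) t := by
  rw [← hasDerivWithinAt_Iio_iff_Iic, hasDerivWithinAt_iff_tendsto_slope' (by simp)]
  have h1 : Tendsto (fun s => t - s) (𝓝[<] t) (𝓝[>] 0) := by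
    refine tendsto_nhdsWithin_iff.2 ⟨?_, ?_⟩
    · have : Tendsto (fun s => t - s) (𝓝 t) (𝓝 (t - t)) :=
        (continuous_const.sub continuous_id).tendsto t
      simpa using this.mono_left nhdsWithin_le_nhds
    · filter_upwards [self_mem_nhdsWithin] with s hs
      exact mem_Ioi.2 (sub_pos.2 hs)
  have h2 : Tendsto (fun s : ℝ => s) (𝓝[<] t) (𝓝 t) := tendsto_id.mono_left nhdsWithin_le_nhds
  have h3 := (S.continuous_op_max.tendsto (t, y)).comp (h2.prodMk_nhds (hxy.comp h1))
  simp only [max_eq_left ht.le] at h3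
  refine h3.congr' ?_
  filter_upwards [self_mem_nhdsWithin, nhdsWithin_le_nhds (Ioi_mem_nhds ht)] with s hs hs0
  have hst : s < t := hs
  have hs0' : 0 < s := hs0
  have e : S.op t = (S.op s).comp (S.op (t - s)) := by
    rw [← S.op_add s (t - s) hs0'.le (by linarith)]; congr 1; ring
  have e2 : (s - t)⁻¹ = -(t - s)⁻¹ := by rw [← inv_neg]; congr 1; ring
  simp only [Function.comp_apply, slope, vsub_eq_sub, max_eq_left ht.le, max_eq_left hs0'.le, e,
    ContinuousLinearMap.comp_apply, map_smul, map_sub, e2]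
  rw [neg_smul, ← smul_neg, neg_sub]

end C0Semigroup

end Semigroup

/-! ### Adjoint generators have adjoint semigroups -/

section Duality

variable {H : Type*} [NormedAddCommGroup H] [InnerProductSpace ℝ H] [CompleteSpace H]

/-- Semigroups whose generators are formally adjoint to each other are adjoint. -/
theorem C0Semigroup.inner_op_eq {S S' : C0Semigroup H} {B B' : H → H → Prop}
    (hS : S.IsGeneratedBy B) (hS' : S'.IsGeneratedBy B')
    (hadj : ∀ x y x' y', B x y → B' x' y' → inner ℝ y x' = inner ℝ x y')
    (hd : Dense {x | ∃ y, B x y}) (hd' : Dense {x | ∃ y, B' x y}) {t : ℝ} (ht : 0 ≤ t) (x x' : H) :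
    inner ℝ (S.op t x) x' = inner ℝ x (S'.op t x') := by
  have key : ∀ x ∈ {x | ∃ y, B x y}, ∀ x' ∈ {x | ∃ y, B' x y},
      inner ℝ (S.op t x) x' = inner ℝ x (S'.op t x') := by
    rintro x ⟨y, hxy⟩ x' ⟨y', hxy'⟩
    have inv : ∀ s, 0 ≤ s → B (S.op s x) (S.op s y) := fun s hs =>
      (hS _ _).2 (S.tendsto_quotient_op ((hS x y).1 hxy) hs)
    have inv' : ∀ s, 0 ≤ s → B' (S'.op s x') (S'.op s y') := fun s hs =>
      (hS' _ _).2 (S'.tendsto_quotient_op ((hS' x' y').1 hxy') hs)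
    -- `φ` joins the two sides of the claim: `s = 0` gives the left one and `s = t` the right one.
    -- Its derivative is the difference of the two generator terms, which cancel by `hadj`, so `φ`
    -- is constant.
    let φ : ℝ → ℝ := fun s => inner ℝ (S.op (max (t - s) 0) x) (S'.op (max s 0) x')
    have hcont : Continuous φ :=
      Continuous.inner
        (S.continuous_op_max.comp (Continuous.prodMk (continuous_const.sub continuous_id)
          (continuous_const (y := x))))
        (S'.continuous_op_max.comp (Continuous.prodMk continuous_id (continuous_const (y := x'))))
    have hder : ∀ s ∈ Ico 0 t, HasDerivWithinAt φ 0 (Ici s) s := by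
      intro s hs
      -- The reflection `s ↦ t - s` turns the left derivative of the orbit into the right derivative
      -- required here.
      have h1 : HasDerivWithinAt (fun s => S.op (max (t - s) 0) x) ((-1 : ℝ) • S.op (t - s) y)
          (Ici s) s :=
        HasDerivWithinAt.scomp s (t' := Iic (t - s))
          (S.hasDerivWithinAt_Iic ((hS x y).1 hxy) (sub_pos.2 hs.2))
          ((hasDerivWithinAt_id s _).const_sub t) fun r (hr : s ≤ r) =>
            show t - r ≤ t - s by linarith
      have h2 : HasDerivWithinAt (fun s => S'.op (max s 0) x') (S'.op s y') (Ici s) s := by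
        refine (S'.hasDerivWithinAt_Ici ((hS' x' y').1 hxy') hs.1).congr_of_mem ?_ self_mem_Ici
        intro r hr
        rw [max_eq_left (hs.1.trans hr)]
      have h3 := h1.inner ℝ h2
      have hts : 0 ≤ t - s := by linarith [hs.2]
      have h4 := hadj _ _ _ _ (inv (t - s) hts) (inv' s hs.1)
      simp only [max_eq_left hs.1, max_eq_left hts] at h3
      rw [inner_smul_left, h4] at h3
      simpa using h3
    have := constant_of_has_deriv_right_zero hcont.continuousOn hder t ⟨ht, le_rfl⟩
    simp only [φ, sub_self, max_self, sub_zero, max_eq_left ht, S.op_zero, S'.op_zero] at this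
    exact this.symm
  have step : ∀ x ∈ {x | ∃ y, B x y}, ∀ x', inner ℝ (S.op t x) x' = inner ℝ x (S'.op t x') := by
    intro x hx x'
    have := Continuous.ext_on hd' (f := fun x' => inner ℝ (S.op t x) x')
      (g := fun x' => inner ℝ x (S'.op t x')) (by fun_prop) (by fun_prop) (key x hx)
    exact congrFun this x'
  have := Continuous.ext_on hd (f := fun x => inner ℝ (S.op t x) x')
    (g := fun x => inner ℝ x (S'.op t x')) (by fun_prop) (by fun_prop) fun x hx => step x hx x'
  exact congrFun this x

end Duality

/-! ### Generation of contraction semigroups by bounded dissipative approximation -/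

section Generation

variable {H : Type*} [NormedAddCommGroup H] [InnerProductSpace ℝ H] [CompleteSpace H]

omit [InnerProductSpace ℝ H] in
theorem hasDerivAt_exp_smul_apply [NormedSpace ℝ H] (Y : H →L[ℝ] H) (x : H) (t : ℝ) :
    HasDerivAt (fun t : ℝ => NormedSpace.exp (t • Y) x) (NormedSpace.exp (t • Y) (Y x)) t := by
  have h := (hasDerivAt_exp_smul_const (𝕂 := ℝ) Y t).clm_apply (hasDerivAt_const t x)
  simpa using h

omit [InnerProductSpace ℝ H] [CompleteSpace H] in
theorem commute_exp_smul [NormedSpace ℝ H] {Y Z : H →L[ℝ] H} (h : Commute Y Z) (t : ℝ) :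
    Commute Y (NormedSpace.exp (t • Z)) :=
  (h.smul_right t).exp_right

/-- Along the flow of `Y`, the derivative of `‖u‖ ^ 2` is `2 ⟨Y u, u⟩ ≤ 0`. -/
theorem norm_exp_smul_apply_le {Y : H →L[ℝ] H} (hY : ∀ x, inner ℝ (Y x) x ≤ 0) {t : ℝ} (ht : 0 ≤ t)
    (x : H) : ‖NormedSpace.exp (t • Y) x‖ ≤ ‖x‖ := by
  have hd : ∀ s : ℝ, HasDerivAt (fun s : ℝ => ‖NormedSpace.exp (s • Y) x‖ ^ 2)
      (2 * inner ℝ (NormedSpace.exp (s • Y) x) (NormedSpace.exp (s • Y) (Y x))) s := fun s =>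
    (hasDerivAt_exp_smul_apply Y x s).norm_sq
  have hanti : Antitone (fun s : ℝ => ‖NormedSpace.exp (s • Y) x‖ ^ 2) := by
    refine antitone_of_hasDerivAt_nonpos hd fun s => ?_
    have e : NormedSpace.exp (s • Y) (Y x) = Y (NormedSpace.exp (s • Y) x) :=
      (DFunLike.congr_fun (commute_exp_smul (Commute.refl Y) s) x).symm
    rw [e, real_inner_comm]
    exact mul_nonpos_of_nonneg_of_nonpos zero_le_two (hY _)
  have := hanti ht
  simp only [zero_smul, NormedSpace.exp_zero, one_apply_eq_self] at this
  exact le_of_sq_le_sq this (norm_nonneg _)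

/-- Interpolate by `s ↦ exp ((t - s) Z) exp (s Y) x`. As `Y` and `Z` commute, its derivative is two
contractions applied to `Y x - Z x`. This makes the approximating semigroups Cauchy. -/
theorem norm_exp_smul_sub_le {Y Z : H →L[ℝ] H} (hYZ : Commute Y Z)
    (hY : ∀ x, inner ℝ (Y x) x ≤ 0) (hZ : ∀ x, inner ℝ (Z x) x ≤ 0) {t : ℝ} (ht : 0 ≤ t) (x : H) :
    ‖NormedSpace.exp (t • Y) x - NormedSpace.exp (t • Z) x‖ ≤ ‖Y x - Z x‖ * t := by
  have hd : ∀ s : ℝ, HasDerivAt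
      (fun s : ℝ => NormedSpace.exp ((t - s) • Z) (NormedSpace.exp (s • Y) x))
      (NormedSpace.exp ((t - s) • Z) (NormedSpace.exp (s • Y) (Y x - Z x))) s := by
    intro s
    have h1 : HasDerivAt (fun s : ℝ => NormedSpace.exp ((t - s) • Z))
        ((-1 : ℝ) • (NormedSpace.exp ((t - s) • Z) * Z)) s :=
      HasDerivAt.scomp s (hasDerivAt_exp_smul_const (𝕂 := ℝ) Z (t - s))
        ((hasDerivAt_id s).const_sub t)
    refine (h1.clm_apply (hasDerivAt_exp_smul_apply Y x s)).congr_deriv ?_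
    have e : Z (NormedSpace.exp (s • Y) x) = NormedSpace.exp (s • Y) (Z x) :=
      DFunLike.congr_fun (commute_exp_smul hYZ.symm s) x
    rw [neg_smul, one_smul, neg_apply, map_sub, map_sub, ← e]
    exact neg_add_eq_sub _ _
  have := norm_image_sub_le_of_norm_deriv_le_segment' (a := 0) (b := t) (C := ‖Y x - Z x‖)
    (fun s _ => (hd s).hasDerivWithinAt)
    (fun s hs => (norm_exp_smul_apply_le hZ (by linarith [hs.2]) _).trans
      (norm_exp_smul_apply_le hY hs.1 _)) t ⟨ht, le_rfl⟩
  simpa using this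

theorem norm_exp_smul_sub_self_le {Y : H →L[ℝ] H}
    (hY : ∀ x, inner ℝ (Y x) x ≤ 0) {t : ℝ} (ht : 0 ≤ t) (x : H) :
    ‖NormedSpace.exp (t • Y) x - x‖ ≤ ‖Y x‖ * t := by
  simpa using norm_exp_smul_sub_le (Commute.zero_right Y) hY (fun x => by simp) ht x

/-- Here `y` stands for the generator at `x` and may lie outside its domain, where the
approximations `Y y` are not controlled. Replacing `y` by a nearby domain element `z` costs `2 * ‖y
- z‖` and leaves only the bounded quantity `‖Y z‖`. -/
theorem norm_exp_smul_sub_sub_le {Y : H →L[ℝ] H}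
    (hY : ∀ x, inner ℝ (Y x) x ≤ 0) {t : ℝ} (ht : 0 ≤ t) (x y z : H) :
    ‖NormedSpace.exp (t • Y) x - x - t • y‖ ≤ (‖Y x - y‖ + 2 * ‖y - z‖ + ‖Y z‖ * t) * t := by
  have hd : ∀ s : ℝ, HasDerivAt (fun s : ℝ => NormedSpace.exp (s • Y) x - x - s • y)
      (NormedSpace.exp (s • Y) (Y x) - y) s := by
    intro s
    refine (((hasDerivAt_exp_smul_apply Y x s).sub_const x).sub
      ((hasDerivAt_id s).smul_const y)).congr_deriv ?_
    rw [one_smul]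
  have := norm_image_sub_le_of_norm_deriv_le_segment' (a := 0) (b := t)
    (C := ‖Y x - y‖ + 2 * ‖y - z‖ + ‖Y z‖ * t)
    (fun s _ => (hd s).hasDerivWithinAt)
    (fun s hs => by
      have e : NormedSpace.exp (s • Y) (Y x) - y = NormedSpace.exp (s • Y) (Y x - y)
          + NormedSpace.exp (s • Y) (y - z) + (NormedSpace.exp (s • Y) z - z) + (z - y) := by
        simp only [map_sub]; abel
      rw [e]
      have h1 := norm_exp_smul_apply_le hY hs.1 (Y x - y)
      have h2 := norm_exp_smul_apply_le hY hs.1 (y - z)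
      have h3 := norm_exp_smul_sub_self_le hY hs.1 z
      have h4 : ‖Y z‖ * s ≤ ‖Y z‖ * t := mul_le_mul_of_nonneg_left hs.2.le (norm_nonneg _)
      have h5 := norm_sub_rev z y
      refine (norm_add₄_le).trans ?_
      linarith) t ⟨ht, le_rfl⟩
  simpa using this

/-- Pointwise limits of bounded operators that are bounded by a common constant. -/
theorem exists_clm_of_tendsto {E : ℕ → H →L[ℝ] H} (hE : ∀ n x, ‖E n x‖ ≤ ‖x‖) {D : Set H}
    (hD : Dense D) (hC : ∀ x ∈ D, CauchySeq fun n => E n x) :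
    ∃ G : H →L[ℝ] H, ∀ x, Tendsto (fun n => E n x) atTop (𝓝 (G x)) := by
  have hC' : ∀ x, CauchySeq fun n => E n x := by
    intro x
    rw [Metric.cauchySeq_iff']
    intro ε hε
    obtain ⟨z, hz, hxz⟩ := Metric.mem_closure_iff.1 (hD x) (ε / 3) (by positivity)
    obtain ⟨N, hN⟩ := Metric.cauchySeq_iff'.1 (hC z hz) (ε / 3) (by positivity)
    refine ⟨N, fun n hn => ?_⟩
    have h1 : ∀ n, dist (E n x) (E n z) < ε / 3 := fun n => by
      rw [dist_eq_norm, ← map_sub]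
      exact (hE n _).trans_lt (by rwa [← dist_eq_norm])
    have h2 := hN n hn
    have h3 := dist_triangle4 (E n x) (E n z) (E N z) (E N x)
    have h4 := h1 N
    rw [dist_comm] at h4
    linarith [h1 n]
  choose G hG using fun x => cauchySeq_tendsto_of_complete (hC' x)
  refine ⟨LinearMap.mkContinuous { toFun := G, map_add' := ?_, map_smul' := ?_ } 1 ?_, hG⟩
  · intro x y
    refine tendsto_nhds_unique (hG (x + y)) ?_
    simpa only [map_add] using (hG x).add (hG y)
  · intro r x
    refine tendsto_nhds_unique (hG (r • x)) ?_
    simpa only [map_smul, RingHom.id_apply] using (hG x).const_smul r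
  · intro x
    rw [one_mul]
    exact le_of_tendsto (hG x).norm (Eventually.of_forall fun n => hE n x)

/-- A generation theorem for contraction semigroups in terms of commuting bounded dissipative
approximations of the generator. -/
theorem exists_c0Semigroup_of_approx {C : H → H → Prop} (Y : ℕ → H →L[ℝ] H)
    (hcomm : ∀ n k, Commute (Y n) (Y k)) (hY : ∀ n x, inner ℝ (Y n x) x ≤ 0)
    (hlim : ∀ x y, C x y → Tendsto (fun n => Y n x) atTop (𝓝 y))
    (hd : Dense {x | ∃ y, C x y})
    (hrange : ∀ f, ∃ x y, C x y ∧ x - y = f) :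
    ∃ S : C0Semigroup H, S.IsGeneratedBy C := by
  have hE : ∀ t : ℝ, ∀ n x, ‖NormedSpace.exp ((max t 0) • Y n) x‖ ≤ ‖x‖ := fun t n x =>
    norm_exp_smul_apply_le (hY n) (le_max_right _ _) x
  have hcau : ∀ t : ℝ, ∀ x ∈ {x | ∃ y, C x y},
      CauchySeq fun n => NormedSpace.exp ((max t 0) • Y n) x := by
    rintro t x ⟨y, hxy⟩
    have h1 := (hlim x y hxy).cauchySeq
    rw [Metric.cauchySeq_iff'] at h1 ⊢
    intro ε hε
    obtain ⟨N, hN⟩ := h1 (ε / (max t 0 + 1)) (by positivity)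
    refine ⟨N, fun n hn => ?_⟩
    have h2 := hN n hn
    rw [dist_eq_norm] at h2 ⊢
    have ht : 0 ≤ max t 0 := le_max_right _ _
    refine (norm_exp_smul_sub_le (hcomm n N) (hY n) (hY N) ht x).trans_lt ?_
    rw [lt_div_iff₀ (by positivity)] at h2
    nlinarith [norm_nonneg (Y n x - Y N x)]
  choose G hG using fun t : ℝ => exists_clm_of_tendsto (hE t) hd (hcau t)
  have hG' : ∀ t, 0 ≤ t → ∀ x, Tendsto (fun n => NormedSpace.exp (t • Y n) x) atTop
      (𝓝 (G t x)) := fun t ht x => by simpa only [max_eq_left ht] using hG t x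
  have hGn : ∀ t x, ‖G t x‖ ≤ ‖x‖ := fun t x =>
    le_of_tendsto (hG t x).norm (Eventually.of_forall fun n => hE t n x)
  -- quantitative differentiability at zero
  have hquant : ∀ x y z z', C x y → C z z' → ∀ t, 0 ≤ t →
      ‖G t x - x - t • y‖ ≤ (2 * ‖y - z‖ + ‖z'‖ * t) * t := by
    intro x y z z' hxy hz t ht
    have h1 : Tendsto (fun n => ‖NormedSpace.exp (t • Y n) x - x - t • y‖) atTop
        (𝓝 ‖G t x - x - t • y‖) := (((hG' t ht x).sub_const x).sub_const _).norm
    have h2 : Tendsto (fun n => (‖Y n x - y‖ + 2 * ‖y - z‖ + ‖Y n z‖ * t) * t) atTop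
        (𝓝 ((‖y - y‖ + 2 * ‖y - z‖ + ‖z'‖ * t) * t)) :=
      (((((hlim x y hxy).sub_const y).norm).add_const _).add
        ((hlim z z' hz).norm.mul_const t)).mul_const t
    rw [sub_self, norm_zero, zero_add] at h2
    exact le_of_tendsto_of_tendsto' h1 h2 fun n => norm_exp_smul_sub_sub_le (hY n) ht x y z
  have hderiv : ∀ x y, C x y →
      Tendsto (fun h : ℝ => h⁻¹ • (G h x - x)) (𝓝[>] 0) (𝓝 y) := by
    intro x y hxy
    rw [Metric.tendsto_nhds]
    intro ε hε
    -- The radius `ε / 4` makes the term `2 * ‖y - z‖` of `hquant` less than `ε / 2`; the bound on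
    -- `h` below does the same for `‖z'‖ * h`.
    obtain ⟨z, ⟨z', hz⟩, hyz⟩ := Metric.mem_closure_iff.1 (hd y) (ε / 4) (by positivity)
    have hδ : 0 < ε / (2 * (‖z'‖ + 1)) := by positivity
    filter_upwards [self_mem_nhdsWithin, nhdsWithin_le_nhds (Iio_mem_nhds hδ)] with h hh0 hh1
    have hh0 : 0 < h := hh0
    have hh1 : h < ε / (2 * (‖z'‖ + 1)) := hh1
    rw [dist_eq_norm]
    have e : h⁻¹ • (G h x - x) - y = h⁻¹ • (G h x - x - h • y) := by
      rw [smul_sub h⁻¹ (G h x - x), inv_smul_smul₀ hh0.ne']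
    rw [e, norm_smul, norm_inv, Real.norm_of_nonneg hh0.le]
    have h3 := hquant x y z z' hxy hz h hh0.le
    rw [dist_eq_norm] at hyz
    rw [inv_mul_lt_iff₀ hh0]
    refine h3.trans_lt ?_
    rw [mul_comm]
    refine mul_lt_mul_of_pos_left ?_ hh0
    rw [lt_div_iff₀ (by positivity)] at hh1
    nlinarith [norm_nonneg z']
  have htend : ∀ x : H, Tendsto (fun t => G t x) (𝓝[>] 0) (𝓝 x) := by
    intro x
    rw [Metric.tendsto_nhds]
    intro ε hε
    obtain ⟨z, ⟨z', hz⟩, hxz⟩ := Metric.mem_closure_iff.1 (hd x) (ε / 3) (by positivity)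
    have h1 : Tendsto (fun t => G t z) (𝓝[>] 0) (𝓝 z) := by
      have h2 : Tendsto (fun h : ℝ => h) (𝓝[>] 0) (𝓝 0) := tendsto_id.mono_left nhdsWithin_le_nhds
      have h3 := (h2.smul (hderiv z z' hz)).add_const z
      rw [zero_smul, zero_add] at h3
      refine h3.congr' ?_
      filter_upwards [self_mem_nhdsWithin] with h hh
      rw [smul_inv_smul₀ (ne_of_gt hh), sub_add_cancel]
    filter_upwards [Metric.tendsto_nhds.1 h1 (ε / 3) (by positivity)] with t ht
    have h4 : dist (G t x) (G t z) < ε / 3 := by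
      rw [dist_eq_norm, ← map_sub]
      exact (hGn t _).trans_lt (by rwa [← dist_eq_norm])
    have h5 := dist_triangle4 (G t x) (G t z) z x
    rw [dist_comm] at hxz
    linarith
  let S : C0Semigroup H :=
    { op := G
      op_zero := by
        ext x
        refine tendsto_nhds_unique (hG' 0 le_rfl x) ?_
        simp
      op_add := by
        intro s t hs ht
        ext x
        refine tendsto_nhds_unique (hG' (s + t) (add_nonneg hs ht) x) ?_
        -- Operator and argument both depend on `n`; the error in the argument passes through a
        -- contraction, so it vanishes in the limit.
        have h1 : ∀ n, NormedSpace.exp ((s + t) • Y n) x =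
            NormedSpace.exp (s • Y n) (NormedSpace.exp (t • Y n) x - G t x)
              + NormedSpace.exp (s • Y n) (G t x) := by
          intro n
          let : NormedAlgebra ℚ (H →L[ℝ] H) := NormedAlgebra.restrictScalars ℚ ℝ _
          rw [add_smul, NormedSpace.exp_add_of_commute
            (((Commute.refl (Y n)).smul_left s).smul_right t), map_sub, sub_add_cancel]
          rfl
        simp_rw [h1]
        have h2 : Tendsto (fun n => NormedSpace.exp (s • Y n)
            (NormedSpace.exp (t • Y n) x - G t x)) atTop (𝓝 0) := by
          refine squeeze_zero_norm (fun n => norm_exp_smul_apply_le (hY n) hs _) ?_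
          exact tendsto_iff_norm_sub_tendsto_zero.1 (hG' t ht x)
        simpa using h2.add (hG' s hs (G t x))
      tendsto_zero := htend }
  refine ⟨S, fun x y => ⟨hderiv x y, fun hxy => ?_⟩⟩
  change Tendsto (fun h : ℝ => h⁻¹ • (G h x - x)) (𝓝[>] 0) (𝓝 y) at hxy
  -- The generator extends `C`; maximality gives equality. With `x' - y' = x - y`, the vector `x -
  -- x'` is mapped to itself by the generator, which is dissipative, so it is zero.
  obtain ⟨x', y', hC', he⟩ := hrange (x - y)
  have h1 := hxy.sub (hderiv x' y' hC')
  have hyy : y - y' = x - x' := by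
    have : x - x' - (y - y') = 0 := by rw [← sub_eq_zero.2 he.symm]; abel
    exact (sub_eq_zero.1 this).symm
  have h2 : inner ℝ (y - y') (x - x') ≤ 0 := by
    refine le_of_tendsto (h1.inner (tendsto_const_nhds (x := x - x'))) ?_
    filter_upwards [self_mem_nhdsWithin] with h hh
    rw [← smul_sub, inner_smul_left]
    refine mul_nonpos_of_nonneg_of_nonpos (inv_nonneg.2 (le_of_lt hh)) ?_
    have e : G h x - x - (G h x' - x') = G h (x - x') - (x - x') := by rw [map_sub]; abel
    rw [e, inner_sub_left, real_inner_self_eq_norm_sq]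
    have := (real_inner_le_norm (G h (x - x')) (x - x')).trans
      (mul_le_mul_of_nonneg_right (hGn h (x - x')) (norm_nonneg _))
    linarith
  rw [hyy, real_inner_self_eq_norm_sq] at h2
  have h3 : x - x' = 0 := norm_eq_zero.1 (by nlinarith [norm_nonneg (x - x')])
  rw [h3] at hyy
  rw [sub_eq_zero.1 h3, sub_eq_zero.1 hyy]
  exact hC'

end Generation

/-! ### Exponential rescaling of a semigroup -/

section Rescale

variable {H : Type*} [NormedAddCommGroup H] [NormedSpace ℝ H]

/-- The semigroup `t ↦ exp (ω t) S(t)`. -/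
def C0Semigroup.rescale (S : C0Semigroup H) (ω : ℝ) : C0Semigroup H where
  op t := Real.exp (ω * t) • S.op t
  op_zero := by simp [S.op_zero]
  op_add s t hs ht := by
    ext x
    simp [S.op_add s t hs ht, mul_add, Real.exp_add, smul_smul, mul_comm]
  tendsto_zero x := by
    have h1 : Tendsto (fun t : ℝ => Real.exp (ω * t)) (𝓝[>] 0) (𝓝 1) := by
      have : Continuous fun t : ℝ => Real.exp (ω * t) := by fun_prop
      simpa using (this.tendsto 0).mono_left nhdsWithin_le_nhds
    simpa using h1.smul (S.tendsto_zero x)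

/-- This is the product rule at zero: the scalar factor contributes `ω • x`. The equivalence below
follows by rescaling back with `-ω`. -/
theorem C0Semigroup.tendsto_quotient_rescale (S : C0Semigroup H) (ω : ℝ) {x y : H}
    (h : Tendsto (fun h : ℝ => h⁻¹ • (S.op h x - x)) (𝓝[>] 0) (𝓝 y)) :
    Tendsto (fun h : ℝ => h⁻¹ • ((S.rescale ω).op h x - x)) (𝓝[>] 0) (𝓝 (y + ω • x)) := by
  have h1 : Tendsto (fun t : ℝ => Real.exp (ω * t)) (𝓝[>] 0) (𝓝 1) := by
    have : Continuous fun t : ℝ => Real.exp (ω * t) := by fun_prop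
    simpa using (this.tendsto 0).mono_left nhdsWithin_le_nhds
  have h2 : Tendsto (fun t : ℝ => t⁻¹ * (Real.exp (ω * t) - 1)) (𝓝[>] 0) (𝓝 ω) := by
    have hd : HasDerivAt (fun t : ℝ => Real.exp (ω * t)) ω 0 := by
      simpa using ((hasDerivAt_id (0 : ℝ)).const_mul ω).exp
    have := (hasDerivAt_iff_tendsto_slope.1 hd).mono_left
      (nhdsWithin_mono 0 (fun t (ht : t ∈ Ioi (0 : ℝ)) => by
        simpa using ne_of_gt ht : Ioi (0 : ℝ) ⊆ {0}ᶜ))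
    refine this.congr fun t => ?_
    simp [slope]
  have h3 := (h1.smul h).add (h2.smul_const x)
  rw [one_smul] at h3
  refine h3.congr fun t => ?_
  simp only [rescale, smul_apply]
  module

theorem C0Semigroup.tendsto_quotient_rescale_iff (S : C0Semigroup H) (ω : ℝ) (x y : H) :
    Tendsto (fun h : ℝ => h⁻¹ • ((S.rescale ω).op h x - x)) (𝓝[>] 0) (𝓝 y) ↔
      Tendsto (fun h : ℝ => h⁻¹ • (S.op h x - x)) (𝓝[>] 0) (𝓝 (y - ω • x)) := by
  constructor
  · intro h
    have h1 := (S.rescale ω).tendsto_quotient_rescale (-ω) h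
    rw [neg_smul, ← sub_eq_add_neg] at h1
    refine h1.congr fun t => ?_
    simp [rescale, smul_smul, ← Real.exp_add]
  · intro h
    simpa using S.tendsto_quotient_rescale ω h

end Rescale

/-! ### Lumer-Phillips and bounded perturbations of skew-adjoint operators -/

section Generation

variable {H : Type*} [NormedAddCommGroup H] [InnerProductSpace ℝ H] [CompleteSpace H]

omit [CompleteSpace H] in
-- Pair `l • x - y` with `x` and apply Cauchy-Schwarz. This gives injectivity and the bound on
-- resolvents.
theorem mul_norm_le_of_inner_nonpos {l : ℝ} {x y : H} (h : inner ℝ y x ≤ 0) :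
    l * ‖x‖ ≤ ‖l • x - y‖ := by
  rcases eq_or_ne x 0 with rfl | hx
  · simp
  have hx' : 0 < ‖x‖ := norm_pos_iff.2 hx
  have h1 := real_inner_le_norm (l • x - y) x
  rw [inner_sub_left, inner_smul_left, real_inner_self_eq_norm_sq] at h1
  simp only [conj_trivial] at h1
  refine le_of_mul_le_mul_right ?_ hx'
  nlinarith

/-- The Lumer-Phillips theorem in Hilbert spaces. -/
theorem exists_c0Semigroup_of_dissipative (C : Submodule ℝ (H × H))
    (hdiss : ∀ x y, (x, y) ∈ C → inner ℝ y x ≤ 0)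
    (hrange : ∀ l : ℝ, 0 < l → ∀ f, ∃ x y, (x, y) ∈ C ∧ l • x - y = f)
    (hd : Dense {x | ∃ y, (x, y) ∈ C}) :
    ∃ S : C0Semigroup H, S.IsGeneratedBy fun x y => (x, y) ∈ C := by
  have huniq : ∀ l : ℝ, 0 < l → ∀ x y x' y', (x, y) ∈ C → (x', y') ∈ C →
      l • x - y = l • x' - y' → x = x' := by
    intro l hl x y x' y' h h' e
    have h1 := mul_norm_le_of_inner_nonpos (l := l) (hdiss _ _ (C.sub_mem h h'))
    have e2 : l • (x - x') - (y - y') = 0 := by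
      rw [smul_sub, ← sub_eq_zero.2 e]; abel
    simp only at h1
    rw [e2, norm_zero] at h1
    have h2 : ‖x - x'‖ ≤ 0 := by
      by_contra! hc
      exact absurd h1 (not_le.2 (mul_pos hl hc))
    exact sub_eq_zero.1 (norm_le_zero_iff.1 h2)
  have hres : ∀ l : ℝ, 0 < l → ∃ R : H →L[ℝ] H,
      (∀ f, (R f, l • R f - f) ∈ C) ∧ ∀ f, ‖l • R f‖ ≤ ‖f‖ := by
    intro l hl
    have hex : ∀ f, ∃ x, (x, l • x - f) ∈ C := fun f => by
      obtain ⟨x, y, hxy, rfl⟩ := hrange l hl f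
      exact ⟨x, by simpa using hxy⟩
    choose R hR using hex
    have hb : ∀ f, ‖l • R f‖ ≤ ‖f‖ := fun f => by
      have := mul_norm_le_of_inner_nonpos (l := l) (hdiss _ _ (hR f))
      simp only [sub_sub_cancel] at this
      rwa [norm_smul, Real.norm_of_nonneg hl.le]
    refine ⟨LinearMap.mkContinuous { toFun := R, map_add' := ?_, map_smul' := ?_ } l⁻¹ ?_, hR, hb⟩
    · intro f g
      refine huniq l hl _ _ _ _ (hR (f + g)) (C.add_mem (hR f) (hR g)) ?_
      simp only [smul_add]; abel
    · intro r f
      refine huniq l hl _ _ _ _ (hR (r • f)) (C.smul_mem r (hR f)) ?_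
      simp only [RingHom.id_apply, smul_sub, smul_comm l r]; abel
    · intro f
      have := hb f
      rw [norm_smul, Real.norm_of_nonneg hl.le] at this
      rw [inv_mul_eq_div, le_div_iff₀ hl, mul_comm]
      exact this
  have hpos : ∀ n : ℕ, 0 < (n : ℝ) + 1 := fun n => by positivity
  choose R hR hRn using fun n : ℕ => hres (n + 1) (hpos n)
  have hRC : ∀ n x y, (x, y) ∈ C → R n (((n : ℝ) + 1) • x - y) = x := fun n x y hxy =>
    huniq _ (hpos n) _ _ _ _ (hR n _) hxy (by abel)
  -- Yosida approximation with `λ = n + 1`: on the domain, `λ (λ R - 1)` equals `λ R` applied after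
  -- the generator, and `λ R` tends strongly to the identity.
  let Y : ℕ → H →L[ℝ] H := fun n => ((n : ℝ) + 1) • (((n : ℝ) + 1) • R n - 1)
  have hYC : ∀ n x y, (x, y) ∈ C → Y n x = ((n : ℝ) + 1) • R n y := by
    intro n x y hxy
    have h1 := hRC n x y hxy
    rw [map_sub, map_smul] at h1
    simp only [Y, smul_apply, sub_apply, one_apply_eq_self]
    rw [sub_eq_iff_eq_add'.1 h1]
    simp
  have hJ : ∀ x, Tendsto (fun n : ℕ => ((n : ℝ) + 1) • R n x) atTop (𝓝 x) := by
    have hJD : ∀ x y, (x, y) ∈ C → ∀ n : ℕ, ‖((n : ℝ) + 1) • R n x - x‖ ≤ ‖y‖ * (1 / ((n : ℝ) + 1)) := by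
      intro x y hxy n
      have h1 := hRC n x y hxy
      rw [map_sub, map_smul] at h1
      have h2 : ((n : ℝ) + 1) • R n x - x = R n y := by
        rw [← sub_sub_cancel (((n : ℝ) + 1) • R n x) (R n y), h1]
      have h3 := hRn n y
      rw [norm_smul, Real.norm_of_nonneg (hpos n).le] at h3
      rw [h2, mul_one_div, le_div_iff₀ (hpos n), mul_comm]
      exact h3
    intro x
    rw [Metric.tendsto_atTop]
    intro ε hε
    obtain ⟨z, ⟨z', hz⟩, hxz⟩ := Metric.mem_closure_iff.1 (hd x) (ε / 3) (by positivity)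
    have h1 : Tendsto (fun n : ℕ => ((n : ℝ) + 1) • R n z) atTop (𝓝 z) := by
      refine tendsto_iff_norm_sub_tendsto_zero.2
        (squeeze_zero (fun _ => norm_nonneg _) (hJD z z' hz) ?_)
      simpa using tendsto_one_div_add_atTop_nhds_zero_nat.const_mul ‖z'‖
    obtain ⟨N, hN⟩ := Metric.tendsto_atTop.1 h1 (ε / 3) (by positivity)
    refine ⟨N, fun n hn => ?_⟩
    have h2 := hN n hn
    have h3 : dist (((n : ℝ) + 1) • R n x) (((n : ℝ) + 1) • R n z) < ε / 3 := by
      rw [dist_eq_norm, ← smul_sub, ← map_sub]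
      exact (hRn n _).trans_lt (by rwa [← dist_eq_norm])
    have h4 := dist_triangle4 (((n : ℝ) + 1) • R n x) (((n : ℝ) + 1) • R n z) z x
    rw [dist_comm] at hxz
    linarith
  have hcomm : ∀ n k, Commute (R n) (R k) := by
    intro n k
    ext f
    have h1 := hR n (R k f)
    have h2 := hR k f
    -- This combination is built for the resolvent identity `h5`, which shows that `R n (R k f)` and
    -- `R k (R n f)` solve the same equation at `k + 1`.
    have h3 := C.add_mem h2 (C.smul_mem ((k : ℝ) - n) h1)
    have h4 := hRC n _ _ h3
    change R n (R k f) = R k (R n f)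
    refine huniq (k + 1) (hpos k) _ _ _ _ h1 (hR k (R n f)) ?_
    have h5 : R n f = R k f + ((k : ℝ) - n) • R n (R k f) := by
      refine Eq.trans ?_ h4
      congr 1
      simp only [Prod.smul_fst, Prod.smul_snd]
      module
    rw [h5]
    module
  refine exists_c0Semigroup_of_approx Y ?_ ?_ ?_ hd ?_
  · intro n k
    have h1 : Commute (((n : ℝ) + 1) • R n - 1) (((k : ℝ) + 1) • R k - 1) :=
      ((((hcomm n k).smul_left _).smul_right _).sub_left (Commute.one_left _)).sub_right
        (Commute.one_right _)
    exact (h1.smul_left _).smul_right _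
  · intro n x
    simp only [Y, smul_apply, sub_apply, one_apply_eq_self]
    rw [inner_smul_left, inner_sub_left, real_inner_self_eq_norm_sq]
    refine mul_nonpos_of_nonneg_of_nonpos (hpos n).le ?_
    have := (real_inner_le_norm (((n : ℝ) + 1) • R n x) x).trans
      (mul_le_mul_of_nonneg_right (hRn n x) (norm_nonneg _))
    linarith
  · intro x y hxy
    simp_rw [fun n => hYC n x y hxy]
    exact hJ y
  · intro f
    obtain ⟨x, y, hxy, h⟩ := hrange 1 one_pos f
    exact ⟨x, y, hxy, by simpa using h⟩

/-- `A` is the graph of a skew-adjoint operator. -/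
structure IsSkewAdjointGraph (A : H → H → Prop) : Prop where
  mem_iff : ∀ x y, A x y ↔ ∀ x' y', A x' y' → inner ℝ y x' = -inner ℝ x y'
  eq_zero : ∀ y, A 0 y → y = 0

namespace IsSkewAdjointGraph

variable {A : H → H → Prop}

/-- The graph as a subspace. -/
def graph (hA : IsSkewAdjointGraph A) : Submodule ℝ (H × H) where
  carrier := {z | A z.1 z.2}
  add_mem' := by
    rintro ⟨x, y⟩ ⟨x₂, y₂⟩ h h₂
    change A x y at h
    change A x₂ y₂ at h₂
    refine (hA.mem_iff (x + x₂) (y + y₂)).2 fun x' y' h' => ?_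
    rw [inner_add_left, inner_add_left, (hA.mem_iff _ _).1 h x' y' h',
      (hA.mem_iff _ _).1 h₂ x' y' h']
    ring
  zero_mem' := by
    refine (hA.mem_iff 0 0).2 fun x' y' h' => ?_
    simp
  smul_mem' := by
    rintro r ⟨x, y⟩ h
    change A x y at h
    refine (hA.mem_iff (r • x) (r • y)).2 fun x' y' h' => ?_
    rw [inner_smul_left, inner_smul_left, (hA.mem_iff _ _).1 h x' y' h']
    ring

omit [CompleteSpace H] in
theorem inner_self (hA : IsSkewAdjointGraph A) {x y : H} (h : A x y) : inner ℝ y x = 0 := by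
  have := (hA.mem_iff x y).1 h x y h
  rw [real_inner_comm x y] at this ⊢
  linarith

omit [CompleteSpace H] in
theorem neg (hA : IsSkewAdjointGraph A) : IsSkewAdjointGraph fun x y => A x (-y) where
  mem_iff x y := by
    rw [hA.mem_iff]
    constructor
    · intro h x' y' h'
      have := h x' (-y') h'
      simp only [inner_neg_left, inner_neg_right] at this
      linarith
    · intro h x' y' h'
      have := h x' (-y') (by simpa using h')
      simp only [inner_neg_left, inner_neg_right] at this ⊢
      linarith
  eq_zero y h := neg_eq_zero.1 (hA.eq_zero _ h)

/-- A vector `y` orthogonal to the domain passes the test for `A 0 y`, so it vanishes because the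
graph is single-valued. -/
theorem dense_domain (hA : IsSkewAdjointGraph A) : Dense {x | ∃ y, A x y} := by
  have e : {x | ∃ y, A x y} = (hA.graph.map (LinearMap.fst ℝ H H) : Set H) := by
    ext x
    simp only [mem_ofPred_eq, SetLike.mem_coe, Submodule.mem_map, Prod.exists, LinearMap.fst_apply]
    constructor
    · rintro ⟨y, h⟩; exact ⟨x, y, h, rfl⟩
    · rintro ⟨x, y, h, rfl⟩; exact ⟨y, h⟩
  rw [e, Submodule.dense_iff_topologicalClosure_eq_top, Submodule.topologicalClosure_eq_top_iff,
    Submodule.eq_bot_iff]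
  intro y hy
  refine hA.eq_zero y ((hA.mem_iff 0 y).2 fun x' y' h' => ?_)
  rw [inner_zero_left, neg_zero, real_inner_comm]
  exact (Submodule.mem_orthogonal _ _).1 hy x' ⟨(x', y'), h', rfl⟩

/-- The range of `l - (A + P)` is closed, since `A` is closed and, by `⟨A x, x⟩ = 0`, the operator
is bounded below by `l - ‖P‖`. A vector `z` orthogonal to it lies in the domain of `A* = -A`;
pairing the resulting equation with `z` gives `l ‖z‖ ^ 2 = ⟨z, P z⟩`, so `z = 0`. -/
theorem exists_resolvent (hA : IsSkewAdjointGraph A) (P : H →L[ℝ] H) {l : ℝ} (hl : ‖P‖ < l) (f : H) :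
    ∃ x y, A x y ∧ l • x - (y + P x) = f := by
  let F : H × H →L[ℝ] H := l • ContinuousLinearMap.fst ℝ H H -
    (ContinuousLinearMap.snd ℝ H H + P.comp (ContinuousLinearMap.fst ℝ H H))
  let M : Submodule ℝ H := hA.graph.map F.toLinearMap
  have hF : ∀ x y, F (x, y) = l • x - (y + P x) := fun x y => rfl
  have hlow : ∀ x y, A x y → (l - ‖P‖) * ‖x‖ ≤ ‖F (x, y)‖ := by
    intro x y h
    have h0 : inner ℝ (y + P x - ‖P‖ • x) x ≤ 0 := by
      rw [inner_sub_left, inner_add_left, hA.inner_self h, inner_smul_left,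
        real_inner_self_eq_norm_sq]
      have := (real_inner_le_norm (P x) x).trans
        (mul_le_mul_of_nonneg_right (P.le_opNorm x) (norm_nonneg _))
      simp only [conj_trivial]
      linarith
    refine (mul_norm_le_of_inner_nonpos (l := l - ‖P‖) h0).trans (le_of_eq ?_)
    rw [hF]
    congr 1
    module
  have hclosedA : ∀ (u v : ℕ → H) (x y : H), (∀ n, A (u n) (v n)) → Tendsto u atTop (𝓝 x) →
      Tendsto v atTop (𝓝 y) → A x y := by
    intro u v x y huv hu hv
    rw [hA.mem_iff]
    intro x' y' h'
    refine tendsto_nhds_unique (hv.inner (tendsto_const_nhds (x := x'))) ?_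
    refine ((hu.inner (tendsto_const_nhds (x := y'))).neg).congr fun n => ?_
    exact ((hA.mem_iff _ _).1 (huv n) x' y' h').symm
  have hMclosed : IsClosed (M : Set H) := by
    refine IsSeqClosed.isClosed ?_
    intro g g₀ hg hlim
    have : ∀ n, ∃ z : H × H, A z.1 z.2 ∧ F z = g n := fun n => hg n
    choose z hz hFz using this
    have hcau : CauchySeq fun n => (z n).1 := by
      have h1 := hlim.cauchySeq
      rw [Metric.cauchySeq_iff] at h1 ⊢
      intro ε hε
      have hlP : 0 < l - ‖P‖ := sub_pos.2 hl
      obtain ⟨N, hN⟩ := h1 ((l - ‖P‖) * ε) (by positivity)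
      refine ⟨N, fun n hn k hk => ?_⟩
      have h2 := hN n hn k hk
      rw [dist_eq_norm, ← hFz n, ← hFz k, ← map_sub] at h2
      have h3 := hlow _ _ (hA.graph.sub_mem (hz n) (hz k) : _ ∈ hA.graph)
      rw [dist_eq_norm]
      exact lt_of_mul_lt_mul_left (h3.trans_lt h2) hlP.le
    obtain ⟨x, hx⟩ := cauchySeq_tendsto_of_complete hcau
    have hy : Tendsto (fun n => (z n).2) atTop (𝓝 (l • x - P x - g₀)) := by
      have h1 := ((hx.const_smul l).sub ((P.continuous.tendsto x).comp hx)).sub hlim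
      refine h1.congr fun n => ?_
      rw [← hFz n]
      change l • (z n).1 - P (z n).1 - (l • (z n).1 - ((z n).2 + P (z n).1)) = (z n).2
      abel
    refine ⟨(x, l • x - P x - g₀), hclosedA _ _ _ _ hz hx hy, ?_⟩
    change l • x - (l • x - P x - g₀ + P x) = g₀
    abel
  have hMperp : Mᗮ = ⊥ := by
    rw [Submodule.eq_bot_iff]
    intro z hz
    have h1 : ∀ x y, A x y → inner ℝ (l • x - (y + P x)) z = 0 := fun x y h =>
      (Submodule.mem_orthogonal _ _).1 hz _ ⟨(x, y), h, rfl⟩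
    -- Orthogonality says that `A* z = l z - P* z`; the sign change is `A = -A*`.
    have h2 : A z (-(l • z - ContinuousLinearMap.adjoint P z)) := by
      rw [hA.mem_iff]
      intro x' y' h'
      have h3 := h1 x' y' h'
      rw [inner_sub_left, inner_add_left, inner_smul_left] at h3
      simp only [conj_trivial] at h3
      rw [inner_neg_left, inner_sub_left, inner_smul_left, ContinuousLinearMap.adjoint_inner_left,
        real_inner_comm, real_inner_comm y' z, real_inner_comm (P x') z]
      simp only [conj_trivial]
      linarith
    have h4 := hA.inner_self h2
    rw [inner_neg_left, inner_sub_left, inner_smul_left, ContinuousLinearMap.adjoint_inner_left,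
      real_inner_self_eq_norm_sq] at h4
    simp only [conj_trivial] at h4
    have h5 := (real_inner_le_norm z (P z)).trans
        (mul_le_mul_of_nonneg_left (P.le_opNorm z) (norm_nonneg _))
    by_contra hne
    have h6 : 0 < ‖z‖ ^ 2 := by positivity
    nlinarith
  have hMtop : M = ⊤ := by
    rw [← Submodule.topologicalClosure_eq_top_iff, hMclosed.submodule_topologicalClosure_eq] at hMperp
    exact hMperp
  have : f ∈ M := hMtop ▸ Submodule.mem_top
  obtain ⟨⟨x, y⟩, h, e⟩ := this
  exact ⟨x, y, h, e⟩

/-- A bounded perturbation of a skew-adjoint operator generates a strongly continuous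
semigroup. -/
theorem exists_c0Semigroup (hA : IsSkewAdjointGraph A) (P : H →L[ℝ] H) :
    ∃ S : C0Semigroup H, S.IsGeneratedBy fun x z => ∃ y, A x y ∧ z = y + P x := by
  -- The shift makes `A + Q` dissipative, because `A` contributes nothing to the quadratic form;
  -- `rescale ‖P‖` undoes it at the end.
  let Q : H →L[ℝ] H := P - ‖P‖ • ContinuousLinearMap.id ℝ H
  let F : H × H →ₗ[ℝ] H × H := (LinearMap.fst ℝ H H).prod
    (LinearMap.snd ℝ H H + Q.toLinearMap.comp (LinearMap.fst ℝ H H))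
  let C : Submodule ℝ (H × H) := hA.graph.map F
  have hC : ∀ x w, (x, w) ∈ C ↔ ∃ y, A x y ∧ w = y + (P x - ‖P‖ • x) := by
    intro x w
    constructor
    · rintro ⟨⟨x', y⟩, h, e⟩
      have e1 : x' = x := congrArg Prod.fst e
      have e2 : y + (P x' - ‖P‖ • x') = w := congrArg Prod.snd e
      subst e1
      exact ⟨y, h, e2.symm⟩
    · rintro ⟨y, h, rfl⟩
      exact ⟨(x, y), h, rfl⟩
  have hdiss : ∀ x w, (x, w) ∈ C → inner ℝ w x ≤ 0 := by
    intro x w hw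
    obtain ⟨y, h, rfl⟩ := (hC x w).1 hw
    rw [inner_add_left, inner_sub_left, hA.inner_self h, inner_smul_left,
      real_inner_self_eq_norm_sq]
    have := (real_inner_le_norm (P x) x).trans
      (mul_le_mul_of_nonneg_right (P.le_opNorm x) (norm_nonneg _))
    simp only [conj_trivial]
    linarith
  have hrange : ∀ l : ℝ, 0 < l → ∀ f, ∃ x w, (x, w) ∈ C ∧ l • x - w = f := by
    intro l hl f
    obtain ⟨x, y, h, e⟩ := hA.exists_resolvent P (l := l + ‖P‖) (by linarith) f
    refine ⟨x, _, (hC x _).2 ⟨y, h, rfl⟩, ?_⟩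
    rw [← e]
    module
  have hdense : Dense {x | ∃ w, (x, w) ∈ C} := by
    refine hA.dense_domain.mono ?_
    rintro x ⟨y, h⟩
    exact ⟨_, (hC x _).2 ⟨y, h, rfl⟩⟩
  obtain ⟨S, hS⟩ := exists_c0Semigroup_of_dissipative C hdiss hrange hdense
  refine ⟨S.rescale ‖P‖, fun x z => ?_⟩
  rw [S.tendsto_quotient_rescale_iff, ← hS x]
  refine Iff.trans ?_ (hC _ _).symm
  refine exists_congr fun y => and_congr_right fun _ => ?_
  rw [← add_sub_assoc, sub_left_inj]

end IsSkewAdjointGraph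

end Generation

/-! ### Fixed points of Volterra type maps -/

section Volterra

variable {H : Type*} [NormedAddCommGroup H] [CompleteSpace H]

/-- A map on `C([0,T]; H)` satisfying a Volterra type Lipschitz estimate has a unique fixed
point. -/
theorem existsUnique_isFixedPt_of_volterra {T C : ℝ} (hT : 0 ≤ T) (hC : 0 ≤ C)
    (Ψ : C(Icc (0 : ℝ) T, H) → C(Icc (0 : ℝ) T, H))
    (hΨ : ∀ (w₁ w₂ : C(Icc (0 : ℝ) T, H)) (a : ℝ) (k : ℕ),
      (∀ t, ‖w₁ t - w₂ t‖ ≤ a * (t : ℝ) ^ k) →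
      ∀ t, ‖Ψ w₁ t - Ψ w₂ t‖ ≤ C * a * ((t : ℝ) ^ (k + 1) / (k + 1))) :
    ∃! w, Ψ w = w := by
  -- Iterating the estimate integrates powers of `t`, which produces the factorial. Hence some
  -- iterate contracts for every `T`, and its fixed point is the one of `Ψ`.
  have hiter : ∀ (k : ℕ) (w₁ w₂ : C(Icc (0 : ℝ) T, H)) (t : Icc (0 : ℝ) T),
      ‖Ψ^[k] w₁ t - Ψ^[k] w₂ t‖ ≤ (C ^ k / k.factorial * dist w₁ w₂) * (t : ℝ) ^ k := by
    intro k
    induction k with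
    | zero =>
      intro w₁ w₂ t
      simpa [← dist_eq_norm] using ContinuousMap.dist_apply_le_dist t
    | succ k ih =>
      intro w₁ w₂ t
      rw [Function.iterate_succ_apply', Function.iterate_succ_apply']
      refine (hΨ _ _ _ k (ih w₁ w₂) t).trans (le_of_eq ?_)
      have : (k.factorial : ℝ) ≠ 0 := by positivity
      rw [Nat.factorial_succ, pow_succ C]
      push_cast
      field_simp
  have hlim := FloorSemiring.tendsto_pow_div_factorial_atTop (C * T)
  obtain ⟨k, hk⟩ := (hlim.eventually (gt_mem_nhds zero_lt_one)).exists
  have hk0 : 0 ≤ (C * T) ^ k / k.factorial := by positivity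
  have hcontr : ContractingWith (Real.toNNReal ((C * T) ^ k / k.factorial)) Ψ^[k] := by
    refine ⟨?_, LipschitzWith.of_dist_le_mul fun w₁ w₂ => ?_⟩
    · rwa [Real.toNNReal_lt_one]
    · rw [Real.coe_toNNReal _ hk0]
      refine (ContinuousMap.dist_le (by positivity)).2 fun t => ?_
      rw [dist_eq_norm]
      refine (hiter k w₁ w₂ t).trans ?_
      have h1 : (t : ℝ) ^ k ≤ T ^ k := pow_le_pow_left₀ t.2.1 t.2.2 k
      calc _ ≤ (C ^ k / k.factorial * dist w₁ w₂) * T ^ k :=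
            mul_le_mul_of_nonneg_left h1 (by positivity)
        _ = (C * T) ^ k / k.factorial * dist w₁ w₂ := by rw [mul_pow]; ring
  have : Nonempty C(Icc (0 : ℝ) T, H) := ⟨0⟩
  refine ⟨hcontr.fixedPoint _, hcontr.isFixedPt_fixedPoint_iterate, fun w hw => ?_⟩
  exact hcontr.fixedPoint_unique (Function.IsFixedPt.iterate hw k)

end Volterra

/-! ### Existence and uniqueness of mild solutions -/

section Mild

variable {H : Type*} [NormedAddCommGroup H] [NormedSpace ℝ H] [CompleteSpace H]

theorem C0Semigroup.continuousOn_op_sub (S : C0Semigroup H) {g : ℝ → H} {s : Set ℝ}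
    (hg : ContinuousOn g s) {τ : ℝ → ℝ} (hτ : Continuous τ) (hτ0 : ∀ r ∈ s, 0 ≤ τ r) :
    ContinuousOn (fun r => S.op (τ r) (g r)) s := by
  have h1 := S.continuous_op_max.comp_continuousOn (hτ.continuousOn.prodMk hg)
  refine h1.congr fun r hr => ?_
  simp [max_eq_left (hτ0 r hr)]

theorem continuous_comp_projIcc {X : Type*} [TopologicalSpace X] {T : ℝ} (hT : 0 ≤ T) {g : ℝ → X}
    (hg : ContinuousOn g (Icc 0 T)) : Continuous fun t => g (projIcc 0 T hT t) :=
  hg.comp_continuous (continuous_subtype_val.comp continuous_projIcc) fun t => (projIcc 0 T hT t).2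

/-- Mild solutions with a continuous right hand side satisfy the variation of constants formula for
any semigroup that is the only one with the given generator. -/
theorem isMildForward_iff {B : H → H → Prop} {S : C0Semigroup H} (hS : S.IsGeneratedBy B)
    (huniq : ∀ S' : C0Semigroup H, S'.IsGeneratedBy B → ∀ t, 0 ≤ t → S'.op t = S.op t)
    {T : ℝ} {f : ℝ → H → H} {w : ℝ → H} (hf : ContinuousOn (fun t => f t (w t)) (Icc 0 T)) :
    IsMildForward B T f 0 w ↔
      ∀ t ∈ Icc 0 T, w t = ∫ s in 0..t, S.op (t - s) (f s (w s)) := by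
  constructor
  · rintro ⟨S', hS', h⟩ t ht
    rw [(h t ht).2, map_zero, zero_add]
    refine intervalIntegral.integral_congr fun s hs => ?_
    rw [uIcc_of_le ht.1] at hs
    rw [huniq S' hS' _ (sub_nonneg.2 hs.2)]
  · intro h
    refine ⟨S, hS, fun t ht => ⟨?_, by rw [map_zero, zero_add]; exact h t ht⟩⟩
    refine ContinuousOn.intervalIntegrable ?_
    rw [uIcc_of_le ht.1]
    exact S.continuousOn_op_sub (hf.mono (Icc_subset_Icc_right ht.2)) (by fun_prop)
      fun r hr => sub_nonneg.2 hr.2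

/-- Since `f` is affine in the unknown, the inhomogeneity `b` cancels in differences of the Duhamel
map, leaving a Volterra estimate with constant `M * N` from the bounds on `S` and `F`. -/
theorem existsUnique_isMildForward {B : H → H → Prop} {S : C0Semigroup H} (hS : S.IsGeneratedBy B)
    (huniq : ∀ S' : C0Semigroup H, S'.IsGeneratedBy B → ∀ t, 0 ≤ t → S'.op t = S.op t)
    {T : ℝ} (hT : 0 ≤ T) {f : ℝ → H → H} {F : ℝ → H →L[ℝ] H} {b : ℝ → H}
    (hF : ContinuousOn F (Icc 0 T)) (hb : ContinuousOn b (Icc 0 T))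
    (hf : ∀ t ∈ Icc 0 T, ∀ w, f t w = F t w + b t) :
    ∃! w : C(Icc (0 : ℝ) T, H), IsMildForward B T f 0 (IccExtend hT w) := by
  have hF' := continuous_comp_projIcc hT hF
  have hb' := continuous_comp_projIcc hT hb
  -- Clamping times by `projIcc` here, and by `max` below, makes the integrand continuous on the
  -- whole plane without changing it for `0 ≤ s ≤ t ≤ T`.
  let g : C(Icc (0 : ℝ) T, H) → ℝ → H := fun w s =>
    F (projIcc 0 T hT s) (IccExtend hT w s) + b (projIcc 0 T hT s)
  have hg : ∀ w, Continuous (g w) := fun w =>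
    (hF'.clm_apply w.continuous.Icc_extend').add hb'
  have hgf : ∀ w : C(Icc (0 : ℝ) T, H), ∀ t ∈ Icc 0 T, f t (IccExtend hT w t) = g w t := by
    intro w t ht
    simp only [g]
    rw [hf t ht, projIcc_of_mem hT ht]
  have hk : ∀ w, Continuous fun p : ℝ × ℝ => S.op (max (p.1 - p.2) 0) (g w p.2) := fun w =>
    S.continuous_op_max.comp ((continuous_fst.sub continuous_snd).prodMk
      ((hg w).comp continuous_snd))
  let Ψ : C(Icc (0 : ℝ) T, H) → C(Icc (0 : ℝ) T, H) := fun w =>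
    ⟨fun t => ∫ s in (0 : ℝ)..t, S.op (max ((t : ℝ) - s) 0) (g w s), by
      have h1 := intervalIntegral.continuous_parametric_intervalIntegral_of_continuous
        (μ := volume) (a₀ := 0) (f := fun t s => S.op (max (t - s) 0) (g w s)) (s := id) (hk w)
        continuous_id
      exact h1.comp continuous_subtype_val⟩
  have hΨ : ∀ w (t : Icc (0 : ℝ) T), Ψ w t =
      ∫ s in (0 : ℝ)..t, S.op (max ((t : ℝ) - s) 0) (g w s) := fun w t => rfl
  obtain ⟨M, hM0, hM⟩ := S.exists_bound T
  obtain ⟨N, hN⟩ := isCompact_Icc.exists_bound_of_continuousOn hF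
  have hN0 : 0 ≤ N := (norm_nonneg _).trans (hN 0 ⟨le_rfl, hT⟩)
  have hex : ∃! w, Ψ w = w := by
    refine existsUnique_isFixedPt_of_volterra hT (mul_nonneg hM0 hN0) Ψ ?_
    intro w₁ w₂ a k hw t
    have ht : (0 : ℝ) ≤ t := t.2.1
    have hint : ∀ w, IntervalIntegrable (fun s => S.op (max ((t : ℝ) - s) 0) (g w s)) volume 0 t :=
      fun w => ((hk w).comp (continuous_const.prodMk continuous_id)).intervalIntegrable _ _
    rw [hΨ, hΨ, ← intervalIntegral.integral_sub (hint w₁) (hint w₂)]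
    have h1 : ∀ s ∈ Ioc (0 : ℝ) t, ‖S.op (max ((t : ℝ) - s) 0) (g w₁ s) -
        S.op (max ((t : ℝ) - s) 0) (g w₂ s)‖ ≤ M * N * a * s ^ k := by
      intro s hs
      have hsT : s ∈ Icc 0 T := ⟨hs.1.le, hs.2.trans t.2.2⟩
      have e : g w₁ s - g w₂ s = F s (w₁ ⟨s, hsT⟩ - w₂ ⟨s, hsT⟩) := by
        simp only [g, projIcc_of_mem hT hsT, IccExtend_of_mem hT _ hsT, map_sub]
        abel
      rw [← map_sub, e]
      have hts : max ((t : ℝ) - s) 0 ∈ Icc 0 T :=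
        ⟨le_max_right _ _, max_le (by linarith [hs.1, t.2.2]) hT⟩
      refine ((S.op _).le_of_opNorm_le (hM _ hts) _).trans ?_
      rw [mul_assoc, mul_assoc]
      refine mul_le_mul_of_nonneg_left ?_ hM0
      exact ((F s).le_of_opNorm_le (hN s hsT) _).trans
        (mul_le_mul_of_nonneg_left (hw ⟨s, hsT⟩) hN0)
    refine (intervalIntegral.norm_integral_le_of_norm_le ht (Eventually.of_forall h1)
      ((by fun_prop : Continuous fun s : ℝ => M * N * a * s ^ k).intervalIntegrable _ _)).trans
        (le_of_eq ?_)
    rw [intervalIntegral.integral_const_mul, integral_pow]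
    simp
  refine (existsUnique_congr fun w => ?_).2 hex
  have hcont : ContinuousOn (fun t => f t (IccExtend hT w t)) (Icc 0 T) :=
    (hg w).continuousOn.congr (hgf w)
  rw [isMildForward_iff hS huniq hcont]
  have hint : ∀ t ∈ Icc 0 T, ∫ s in 0..t, S.op (t - s) (f s (IccExtend hT w s)) =
      ∫ s in (0 : ℝ)..t, S.op (max (t - s) 0) (g w s) := by
    intro t ht
    refine intervalIntegral.integral_congr fun s hs => ?_
    rw [uIcc_of_le ht.1] at hs
    rw [hgf w s ⟨hs.1, hs.2.trans ht.2⟩, max_eq_left (sub_nonneg.2 hs.2)]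
  constructor
  · intro h
    ext t
    have := h t t.2
    rw [hint t t.2, IccExtend_val] at this
    exact this.symm
  · intro h t ht
    rw [hint t ht, IccExtend_of_mem hT _ ht]
    exact (DFunLike.congr_fun h ⟨t, ht⟩).symm

omit [CompleteSpace H] in
/-- Time reversal turns backward problems into forward problems. -/
theorem isMildBackward_iff_isMildForward {B : H → H → Prop} {T : ℝ} {g : ℝ → H → H} {p₁ : H}
    {p : ℝ → H} :
    IsMildBackward B T g p₁ p ↔
      IsMildForward B T (fun t => g (T - t)) p₁ (fun t => p (T - t)) := by
  refine exists_congr fun S => and_congr_right fun _ => ?_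
  have hmem : ∀ t, T - t ∈ Icc 0 T ↔ t ∈ Icc 0 T := fun t => by
    simp only [mem_Icc]
    constructor <;> rintro ⟨h1, h2⟩ <;> constructor <;> linarith
  have key : ∀ t, ((IntervalIntegrable (fun s => S.op (s - t) (g s (p s))) volume t T ∧
        p t = S.op (T - t) p₁ + ∫ s in t..T, S.op (s - t) (g s (p s))) ↔
      (IntervalIntegrable (fun s => S.op (T - t - s) (g (T - s) (p (T - s)))) volume 0 (T - t) ∧
        p (T - (T - t)) = S.op (T - t) p₁ +
          ∫ s in 0..(T - t), S.op (T - t - s) (g (T - s) (p (T - s))))) := by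
    intro t
    have e : ∀ s, S.op (T - t - s) (g (T - s) (p (T - s))) =
        (fun r => S.op (r - t) (g r (p r))) (T - s) := fun s => by
      simp only
      congr 2
      ring
    simp_rw [e]
    rw [intervalIntegral.integral_comp_sub_left (fun r => S.op (r - t) (g r (p r))) T,
      sub_sub_cancel, sub_zero]
    refine and_congr_left fun _ => ?_
    constructor
    · intro h
      simpa using (h.comp_sub_left T).symm
    · intro h
      simpa using (h.comp_sub_left T).symm
  constructor
  · intro h t ht
    have h1 := (key (T - t)).1 (h (T - t) ((hmem t).2 ht))
    simpa only [sub_sub_cancel] using h1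
  · intro h t ht
    exact (key t).2 (h (T - t) ((hmem t).2 ht))

/-- The involution `ρ : t ↦ T - t` of the time interval exchanges backward and forward solutions, so
both existence and uniqueness carry over. -/
theorem existsUnique_isMildBackward {B : H → H → Prop} {S : C0Semigroup H} (hS : S.IsGeneratedBy B)
    (huniq : ∀ S' : C0Semigroup H, S'.IsGeneratedBy B → ∀ t, 0 ≤ t → S'.op t = S.op t)
    {T : ℝ} (hT : 0 ≤ T) {f : ℝ → H → H} {F : ℝ → H →L[ℝ] H} {b : ℝ → H}
    (hF : ContinuousOn F (Icc 0 T)) (hb : ContinuousOn b (Icc 0 T))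
    (hf : ∀ t ∈ Icc 0 T, ∀ w, f t w = F t w + b t) :
    ∃! w : C(Icc (0 : ℝ) T, H), IsMildBackward B T f 0 (IccExtend hT w) := by
  have hmaps : MapsTo (fun t => T - t) (Icc 0 T) (Icc 0 T) := fun t ht =>
    ⟨by linarith [ht.2], by linarith [ht.1]⟩
  have hc : Continuous fun t : ℝ => T - t := by fun_prop
  let ρ : C(Icc (0 : ℝ) T, Icc (0 : ℝ) T) := ⟨fun t => ⟨T - t, hmaps t.2⟩, by fun_prop⟩
  have hρρ : ρ.comp ρ = ContinuousMap.id _ := by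
    ext t
    simp [ρ]
  have hrev : ∀ w : C(Icc (0 : ℝ) T, H),
      (fun t => IccExtend hT w (T - t)) = IccExtend hT (w.comp ρ) := by
    intro w
    funext t
    simp only [IccExtend, Function.comp_apply, ContinuousMap.comp_apply]
    congr 1
    ext
    simp only [coe_projIcc, ρ, ContinuousMap.coe_mk]
    -- The case distinction is needed because the functions are compared on all of `ℝ`: reflection
    -- must also match the constant extensions beyond the two end points.
    rcases le_total t 0 with h | h
    · rw [min_eq_left (by linarith : T ≤ T - t), min_eq_right (h.trans hT), max_eq_left h,
        max_eq_right hT, sub_zero]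
    · rw [min_eq_right (by linarith : T - t ≤ T), max_eq_right (le_min hT h)]
      rcases le_total t T with h' | h'
      · rw [min_eq_right h', max_eq_right (by linarith)]
      · rw [min_eq_left h', max_eq_left (by linarith), sub_self]
  obtain ⟨w, hw, hun⟩ := existsUnique_isMildForward hS huniq hT (f := fun t => f (T - t))
    (F := fun t => F (T - t)) (b := fun t => b (T - t)) (hF.comp hc.continuousOn hmaps)
    (hb.comp hc.continuousOn hmaps) fun t ht w => hf _ (hmaps ht) w
  refine ⟨w.comp ρ, ?_, fun p hp => ?_⟩
  · simp only
    rw [isMildBackward_iff_isMildForward, hrev, ContinuousMap.comp_assoc, hρρ,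
      ContinuousMap.comp_id]
    exact hw
  · simp only at hp
    rw [isMildBackward_iff_isMildForward, hrev] at hp
    rw [← hun _ hp, ContinuousMap.comp_assoc, hρρ, ContinuousMap.comp_id]

end Mild

/-! ### The integral identity between dual mild solutions -/

section DualityIdentity

theorem integral_triangle_swap {T : ℝ} (hT : 0 ≤ T) {k : ℝ → ℝ → ℝ}
    (hk : Continuous (Function.uncurry k)) :
    ∫ t in 0..T, ∫ s in 0..t, k t s = ∫ s in 0..T, ∫ t in s..T, k t s := by
  let D : Set (ℝ × ℝ) := {z | z.2 ≤ z.1}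
  have hD : MeasurableSet D := (isClosed_le continuous_snd continuous_fst).measurableSet
  have hint : Integrable (D.indicator (Function.uncurry k))
      ((volume.restrict (Ioc 0 T)).prod (volume.restrict (Ioc 0 T))) := by
    refine Integrable.indicator ?_ hD
    rw [Measure.prod_restrict]
    exact (hk.continuousOn.integrableOn_compact (isCompact_Icc.prod isCompact_Icc)).mono_set
      (prod_mono Ioc_subset_Icc_self Ioc_subset_Icc_self)
  have h1 : ∀ t ∈ Ioc 0 T, ∫ s in Ioc 0 T, D.indicator (Function.uncurry k) (t, s) =
      ∫ s in 0..t, k t s := by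
    intro t ht
    rw [intervalIntegral.integral_of_le ht.1.le]
    have e : (fun s => D.indicator (Function.uncurry k) (t, s)) = (Iic t).indicator (k t) := by
      funext s
      simp [D, indicator_apply]
    rw [e, setIntegral_indicator measurableSet_Iic]
    congr 2
    ext s
    simp only [mem_inter_iff, mem_Ioc, mem_Iic]
    exact ⟨fun h => ⟨h.1.1, h.2⟩, fun h => ⟨⟨h.1, h.2.trans ht.2⟩, h.2⟩⟩
  have h2 : ∀ s ∈ Ioc 0 T, ∫ t in Ioc 0 T, D.indicator (Function.uncurry k) (t, s) =
      ∫ t in s..T, k t s := by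
    intro s hs
    -- The slice of the closed triangle contains the end point `t = s`, so the half-open interval is
    -- exchanged for a closed one.
    rw [intervalIntegral.integral_of_le hs.2, ← integral_Icc_eq_integral_Ioc (x := s)]
    have e : (fun t => D.indicator (Function.uncurry k) (t, s)) =
        (Ici s).indicator (fun t => k t s) := by
      funext t
      simp [D, indicator_apply]
    rw [e, setIntegral_indicator measurableSet_Ici]
    congr 2
    ext t
    simp only [mem_inter_iff, mem_Ioc, mem_Ici, mem_Icc]
    exact ⟨fun h => ⟨h.2, h.1.2⟩, fun h => ⟨⟨hs.1.trans_le h.1, h.2⟩, h.1⟩⟩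
  rw [intervalIntegral.integral_of_le hT, intervalIntegral.integral_of_le hT,
    ← setIntegral_congr_fun measurableSet_Ioc h1, ← setIntegral_congr_fun measurableSet_Ioc h2]
  exact integral_integral_swap hint

variable {H : Type*} [NormedAddCommGroup H] [InnerProductSpace ℝ H] [CompleteSpace H]

/-- The variation of constants formulas of two dual problems are adjoint to each other. -/
theorem integral_inner_mild_eq {S S' : C0Semigroup H}
    (hSS' : ∀ t, 0 ≤ t → ∀ x x', inner ℝ (S.op t x) x' = inner ℝ x (S'.op t x'))
    {T : ℝ} (hT : 0 ≤ T) {f g p w : ℝ → H} (hf : ContinuousOn f (Icc 0 T))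
    (hg : ContinuousOn g (Icc 0 T))
    (hw : ∀ t ∈ Icc 0 T, w t = ∫ s in 0..t, S.op (t - s) (f s))
    (hp : ∀ t ∈ Icc 0 T, p t = ∫ s in t..T, S'.op (s - t) (g s)) :
    ∫ t in 0..T, inner ℝ (g t) (w t) = ∫ t in 0..T, inner ℝ (p t) (f t) := by
  let f' : ℝ → H := fun t => f (projIcc 0 T hT t)
  let g' : ℝ → H := fun t => g (projIcc 0 T hT t)
  have hf' : Continuous f' := continuous_comp_projIcc hT hf
  have hg' : Continuous g' := continuous_comp_projIcc hT hg
  have hff' : ∀ t ∈ Icc 0 T, f' t = f t := fun t ht => by simp only [f', projIcc_of_mem hT ht]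
  have hgg' : ∀ t ∈ Icc 0 T, g' t = g t := fun t ht => by simp only [g', projIcc_of_mem hT ht]
  -- By adjointness this kernel also equals `⟨S'(t - s) g(t), f(s)⟩` on the triangle `s ≤ t`; the
  -- two readings belong to the two sides of the identity.
  let k : ℝ → ℝ → ℝ := fun t s => inner ℝ (g' t) (S.op (max (t - s) 0) (f' s))
  have hk : Continuous (Function.uncurry k) :=
    (hg'.comp continuous_fst).inner (S.continuous_op_max.comp
      ((continuous_fst.sub continuous_snd).prodMk (hf'.comp continuous_snd)))
  have h1 : ∀ t ∈ Icc 0 T, inner ℝ (g t) (w t) = ∫ s in 0..t, k t s := by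
    intro t ht
    have hi : IntervalIntegrable (fun s => S.op (t - s) (f s)) volume 0 t := by
      refine ContinuousOn.intervalIntegrable ?_
      rw [uIcc_of_le ht.1]
      exact S.continuousOn_op_sub (hf.mono (Icc_subset_Icc_right ht.2)) (by fun_prop)
        fun r hr => sub_nonneg.2 hr.2
    have h := (innerSL ℝ (g t)).intervalIntegral_comp_comm hi
    simp only [innerSL_apply_apply] at h
    rw [hw t ht, ← h]
    refine intervalIntegral.integral_congr fun s hs => ?_
    rw [uIcc_of_le ht.1] at hs
    simp only [k]
    rw [hgg' t ht, hff' s ⟨hs.1, hs.2.trans ht.2⟩, max_eq_left (sub_nonneg.2 hs.2)]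
  have h2 : ∀ t ∈ Icc 0 T, inner ℝ (p t) (f t) = ∫ s in t..T, k s t := by
    intro t ht
    have hi : IntervalIntegrable (fun s => S'.op (s - t) (g s)) volume t T := by
      refine ContinuousOn.intervalIntegrable ?_
      rw [uIcc_of_le ht.2]
      exact S'.continuousOn_op_sub (hg.mono (Icc_subset_Icc_left ht.1)) (by fun_prop)
        fun r hr => sub_nonneg.2 hr.1
    have h := (innerSL ℝ (f t)).intervalIntegral_comp_comm hi
    simp only [innerSL_apply_apply] at h
    rw [hp t ht, real_inner_comm, ← h]
    refine intervalIntegral.integral_congr fun s hs => ?_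
    rw [uIcc_of_le ht.2] at hs
    simp only [k]
    rw [hff' t ht, hgg' s ⟨ht.1.trans hs.1, hs.2⟩, max_eq_left (sub_nonneg.2 hs.1),
      ← hSS' _ (sub_nonneg.2 hs.1), real_inner_comm]
  calc ∫ t in 0..T, inner ℝ (g t) (w t) = ∫ t in 0..T, ∫ s in 0..t, k t s :=
        intervalIntegral.integral_congr fun t ht => h1 t (by rwa [uIcc_of_le hT] at ht)
    _ = ∫ t in 0..T, ∫ s in t..T, k s t := integral_triangle_swap hT hk
    _ = ∫ t in 0..T, inner ℝ (p t) (f t) :=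
        intervalIntegral.integral_congr fun t ht => (h2 t (by rwa [uIcc_of_le hT] at ht)).symm

end DualityIdentity

/-! ### Integration by parts and weak derivatives on an interval -/

section Sobolev

variable {a b : ℝ} {f f' g g' : ℝ → ℝ}

theorem intervalIntegrable_of_memLp_two (hab : a ≤ b) (h : MemLp f 2 (volume.restrict (Ioo a b))) :
    IntervalIntegrable f volume a b := by
  rw [intervalIntegrable_iff_integrableOn_Ioo_of_le hab]
  exact h.integrable one_le_two

theorem memLp_of_continuousOn (hf : ContinuousOn f (Icc a b)) :
    MemLp f 2 (volume.restrict (Ioo a b)) := by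
  have h : MemLp f 2 (volume.restrict (Icc a b)) := by
    obtain ⟨C, hC⟩ := isCompact_Icc.exists_bound_of_continuousOn hf
    refine MemLp.of_bound (hf.aestronglyMeasurable measurableSet_Icc) C ?_
    exact (ae_restrict_iff' measurableSet_Icc).2 (Eventually.of_forall hC)
  exact h.mono_measure (Measure.restrict_mono Ioo_subset_Icc_self le_rfl)

theorem isH1On_primitive (C : ℝ) (h : MemLp g 2 (volume.restrict (Ioo a b))) :
    IsH1On a b (fun x => C + ∫ y in a..x, g y) g :=
  ⟨h, fun x _ => by simp⟩

theorem absolutelyContinuousOnInterval_primitive (hab : a ≤ b) (C : ℝ)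
    (h : MemLp g 2 (volume.restrict (Ioo a b))) :
    AbsolutelyContinuousOnInterval (fun x => C + ∫ y in a..x, g y) a b :=
  ((LipschitzWith.const C).lipschitzOnWith.absolutelyContinuousOnInterval).fun_add
    ((intervalIntegrable_of_memLp_two hab h).absolutelyContinuousOnInterval_intervalIntegral
      left_mem_uIcc)

theorem IsH1On.continuousOn (hab : a ≤ b) (h : IsH1On a b f f') : ContinuousOn f (Icc a b) := by
  have h1 := (absolutelyContinuousOnInterval_primitive hab (f a) h.1).continuousOn
  rw [uIcc_of_le hab] at h1
  exact h1.congr h.2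

theorem IsH1On.memLp (hab : a ≤ b) (h : IsH1On a b f f') : MemLp f 2 (volume.restrict (Ioo a b)) :=
  memLp_of_continuousOn (h.continuousOn hab)

theorem ae_hasDerivAt_primitive (hab : a ≤ b) (C : ℝ) (h : MemLp g 2 (volume.restrict (Ioo a b))) :
    ∀ᵐ x, x ∈ Icc a b → HasDerivAt (fun x => C + ∫ y in a..x, g y) (g x) x := by
  filter_upwards [(intervalIntegrable_of_memLp_two hab h).ae_hasDerivAt_integral] with x hx hx'
  rw [uIcc_of_le hab] at hx
  exact (hx hx' a ⟨le_rfl, hab⟩).const_add C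

/-- The product formula for absolutely continuous functions is applied to the primitives, because
`IsH1On` says nothing about `f` and `g` outside `[a, b]`, which could spoil `deriv` at the end
points. -/
theorem IsH1On.integral_parts (hab : a ≤ b) (hf : IsH1On a b f f') (hg : IsH1On a b g g') :
    ∫ x in a..b, (f' x * g x + f x * g' x) = f b * g b - f a * g a := by
  have h := (absolutelyContinuousOnInterval_primitive hab (f a) hf.1).integral_deriv_mul_eq_sub
    (absolutelyContinuousOnInterval_primitive hab (g a) hg.1)
  simp only [← hf.2 b ⟨hab, le_rfl⟩, ← hg.2 b ⟨hab, le_rfl⟩, intervalIntegral.integral_same,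
    add_zero] at h
  rw [← h]
  refine intervalIntegral.integral_congr_ae ?_
  filter_upwards [ae_hasDerivAt_primitive hab (f a) hf.1,
    ae_hasDerivAt_primitive hab (g a) hg.1] with x hx1 hx2 hx
  rw [uIoc_of_le hab] at hx
  have hx' : x ∈ Icc a b := ⟨hx.1.le, hx.2⟩
  rw [(hx1 hx').deriv, (hx2 hx').deriv, ← hf.2 x hx', ← hg.2 x hx']

theorem integrable_mul_of_memLp_two (hab : a ≤ b) (hf : MemLp f 2 (volume.restrict (Ioo a b)))
    (hg : MemLp g 2 (volume.restrict (Ioo a b))) :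
    IntervalIntegrable (fun x => f x * g x) volume a b := by
  rw [intervalIntegrable_iff_integrableOn_Ioo_of_le hab]
  exact hf.integrable_mul hg

/-- A weak derivative of zero vanishes. -/
theorem IsH1On.deriv_ae_eq_zero (hab : a < b) (h : IsH1On a b f f')
    (h0 : f =ᵐ[volume.restrict (Ioo a b)] 0) : f' =ᵐ[volume.restrict (Ioo a b)] 0 := by
  have h1 : EqOn f 0 (Icc a b) := by
    refine Measure.eqOn_Icc_of_ae_eq volume hab.ne ?_ (h.continuousOn hab.le) continuousOn_const
    rwa [restrict_Ioo_eq_restrict_Icc] at h0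
  refine (ae_restrict_iff' measurableSet_Ioo).2 ?_
  filter_upwards [ae_hasDerivAt_primitive hab.le (f a) h.1] with x hx hx'
  refine (hx (Ioo_subset_Icc_self hx')).unique ?_
  refine (hasDerivAt_const x (0 : ℝ)).congr_of_eventuallyEq ?_
  filter_upwards [Ioo_mem_nhds hx'.1 hx'.2] with y hy
  rw [← h.2 y (Ioo_subset_Icc_self hy), h1 (Ioo_subset_Icc_self hy)]
  rfl

/-- The lemma of du Bois-Reymond. -/
theorem ae_eq_const_of_forall_integral_mul_eq_zero (hab : a < b)
    (hf : MemLp f 2 (volume.restrict (Ioo a b)))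
    (h : ∀ φ : ℝ → ℝ, MemLp φ 2 (volume.restrict (Ioo a b)) → ∫ x in a..b, φ x = 0 →
      ∫ x in a..b, f x * φ x = 0) :
    ∃ C, f =ᵐ[volume.restrict (Ioo a b)] fun _ => C := by
  -- With `C` the mean of `f`, the function `f - C` is itself an admissible test function, and
  -- testing with it gives `∫ (f - C) ^ 2 = 0`.
  let C := (b - a)⁻¹ * ∫ x in a..b, f x
  have hba : b - a ≠ 0 := sub_ne_zero.2 hab.ne'
  have hφ : MemLp (fun x => f x - C) 2 (volume.restrict (Ioo a b)) := hf.sub (memLp_const C)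
  have hφ0 : ∫ x in a..b, (f x - C) = 0 := by
    rw [intervalIntegral.integral_sub (intervalIntegrable_of_memLp_two hab.le hf)
      intervalIntegrable_const, intervalIntegral.integral_const, smul_eq_mul]
    simp only [C]
    field_simp
    ring
  have h1 := h _ hφ hφ0
  have h2 : ∫ x in a..b, (f x - C) * (f x - C) = 0 := by
    have e : ∀ x, (f x - C) * (f x - C) = f x * (f x - C) - C * (f x - C) := fun x => by ring
    simp_rw [e]
    rw [intervalIntegral.integral_sub (integrable_mul_of_memLp_two hab.le hf hφ)
      ((intervalIntegrable_of_memLp_two hab.le hφ).const_mul C), h1,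
      intervalIntegral.integral_const_mul, hφ0, mul_zero, sub_zero]
  refine ⟨C, ?_⟩
  rw [intervalIntegral.integral_of_le hab.le, integral_Ioc_eq_integral_Ioo,
    integral_eq_zero_iff_of_nonneg (fun x => mul_self_nonneg _) (hφ.integrable_mul hφ)] at h2
  filter_upwards [h2] with x hx
  exact sub_eq_zero.1 (mul_self_eq_zero.1 hx)

/-- Weak differentiability: `f' = -g` in the sense of distributions. -/
theorem exists_isH1On_of_weak_deriv (hab : a < b) (hf : MemLp f 2 (volume.restrict (Ioo a b)))
    (hg : MemLp g 2 (volume.restrict (Ioo a b)))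
    (h : ∀ Q φ : ℝ → ℝ, IsH1On a b Q φ → Q a = 0 → Q b = 0 →
      ∫ x in a..b, f x * φ x = ∫ x in a..b, g x * Q x) :
    ∃ F, IsH1On a b F (fun x => -g x) ∧ f =ᵐ[volume.restrict (Ioo a b)] F := by
  -- A mean-zero `φ` is the derivative of a `Q` vanishing at both ends. Integrating by parts against
  -- `G`, the hypothesis says that `f + G` annihilates all such `φ`, so it is constant.
  let G : ℝ → ℝ := fun x => 0 + ∫ y in a..x, g y
  have hG : IsH1On a b G g := isH1On_primitive 0 hg
  have hG2 := hG.memLp hab.le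
  obtain ⟨C, hC⟩ := ae_eq_const_of_forall_integral_mul_eq_zero (f := fun x => f x + G x) hab
    (hf.add hG2) fun φ hφ hφ0 => by
      have hQ : IsH1On a b (fun x => 0 + ∫ y in a..x, φ y) φ := isH1On_primitive 0 hφ
      have h1 := hQ.integral_parts hab.le hG
      have h2 := h _ _ hQ (by simp) (by simpa using hφ0)
      have i1 := integrable_mul_of_memLp_two hab.le hf hφ
      have i2 := integrable_mul_of_memLp_two hab.le hφ hG2
      have i3 := integrable_mul_of_memLp_two hab.le (hQ.memLp hab.le) hg
      rw [intervalIntegral.integral_add i2 i3, hφ0] at h1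
      simp only [add_mul]
      rw [intervalIntegral.integral_add i1 (by simpa only [mul_comm] using i2), h2]
      simp only [intervalIntegral.integral_same, add_zero, zero_mul, sub_zero] at h1
      simp only [mul_comm (g _), mul_comm (G _)]
      linarith
  refine ⟨fun x => C + ∫ y in a..x, -g y, isH1On_primitive C hg.neg, ?_⟩
  filter_upwards [hC] with x hx
  rw [intervalIntegral.integral_neg, ← hx]
  simp [G]

end Sobolev

/-! ### Vertex conditions, Green's formula and skew-adjointness of `𝔸` -/

namespace Network

variable {m n : ℕ} (N : Network m n)

/-! ### Vertices -/

theorem ξ_src (k : Fin m) : N.ξ k (N.src k) = -1 := by simp [ξ]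

theorem ξ_tgt (k : Fin m) : N.ξ k (N.tgt k) = 1 := by simp [ξ, (N.no_loop k).symm]

theorem ξ_ne_zero_iff {k : Fin m} {v : Fin n} : N.ξ k v ≠ 0 ↔ v = N.src k ∨ v = N.tgt k := by
  unfold ξ
  split_ifs with h1 h2 <;> simp [h1] <;> simp [*]

theorem ξ_mul_self {k : Fin m} {v : Fin n} (h : N.ξ k v ≠ 0) : N.ξ k v * N.ξ k v = 1 := by
  rcases N.ξ_ne_zero_iff.1 h with rfl | rfl
  · simp [ξ_src]
  · simp [ξ_tgt]

theorem eq_of_notMem_interiorNodes {v : Fin n} (hv : v ∉ N.interiorNodes) {j k : Fin m}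
    (hj : N.ξ j v ≠ 0) (hk : N.ξ k v ≠ 0) : j = k := by
  have h1 : {k | N.ξ k v ≠ 0}.ncard ≤ 1 := not_lt.1 hv
  exact (Set.ncard_le_one (Set.toFinite _)).1 h1 j hj k hk

theorem src_mem_entryNodes {k : Fin m} (h : N.src k ∉ N.interiorNodes) :
    N.src k ∈ N.entryNodes := ⟨h, k, N.ξ_src k⟩

theorem tgt_mem_exitNodes {k : Fin m} (h : N.tgt k ∉ N.interiorNodes) :
    N.tgt k ∈ N.exitNodes := ⟨h, k, N.ξ_tgt k⟩

/-- A non-interior vertex meets a single pipe, which cannot both start and end there. -/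
theorem tgt_notMem_entryNodes {k : Fin m} : N.tgt k ∉ N.entryNodes := by
  rintro ⟨h, j, hj⟩
  have : j = k := N.eq_of_notMem_interiorNodes h (by rw [hj]; norm_num) (by rw [ξ_tgt]; norm_num)
  rw [this, ξ_tgt] at hj
  norm_num at hj

theorem atVertex_src (k : Fin m) (f : ℝ → ℝ) : N.atVertex k (N.src k) f = f 0 := by
  simp [atVertex]

theorem atVertex_tgt (k : Fin m) (f : ℝ → ℝ) : N.atVertex k (N.tgt k) f = f (N.L k) := by
  simp [atVertex, (N.no_loop k).symm]

theorem atVertex_mul (k : Fin m) (v : Fin n) (f g : ℝ → ℝ) :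
    N.atVertex k v (fun x => f x * g x) = N.atVertex k v f * N.atVertex k v g := by
  unfold atVertex
  split_ifs <;> rfl

/-- At vertices off the pipe, `atVertex` takes a default value that `ξ = 0` cancels. This lets
boundary terms of pipes be collected at vertices. -/
theorem sum_ξ_mul_atVertex (k : Fin m) (f : ℝ → ℝ) :
    ∑ v, N.ξ k v * N.atVertex k v f = f (N.L k) - f 0 := by
  have e : ∀ v, N.ξ k v * N.atVertex k v f =
      (if v = N.tgt k then f (N.L k) else 0) - if v = N.src k then f 0 else 0 := by
    intro v
    by_cases h1 : v = N.src k
    · subst h1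
      simp [ξ_src, atVertex_src, N.no_loop k]
    · by_cases h2 : v = N.tgt k
      · subst h2
        simp [ξ_tgt, atVertex_tgt, (N.no_loop k).symm]
      · simp [ξ, h1, h2]
  simp_rw [e]
  rw [Finset.sum_sub_distrib]
  simp

/-- The conditions at the vertices in the domain of `𝔸`. -/
structure VertexConditions (w : Field m) : Prop where
  entry : ∀ k, N.src k ∈ N.entryNodes → w k 0 0 = 0
  exit : ∀ k, N.tgt k ∈ N.exitNodes → w k 1 (N.L k) = 0
  pressure : N.PressureContinuous w
  kirchhoff : N.Kirchhoff w

/-- The boundary form of Green's formula for `𝔸`. -/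
def boundaryForm (w r : Field m) : ℝ :=
  ∑ v, ∑ k, N.ξ k v * N.D k ^ 2 *
    (N.atVertex k v (w k 1) * N.atVertex k v (r k 0) +
      N.atVertex k v (w k 0) * N.atVertex k v (r k 1))

theorem boundaryForm_eq (w r : Field m) :
    N.boundaryForm w r = ∑ k, N.D k ^ 2 *
      ((w k 1 (N.L k) * r k 0 (N.L k) - w k 1 0 * r k 0 0) +
        (w k 0 (N.L k) * r k 1 (N.L k) - w k 0 0 * r k 1 0)) := by
  unfold boundaryForm
  rw [Finset.sum_comm]
  refine Finset.sum_congr rfl fun k _ => ?_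
  rw [← N.sum_ξ_mul_atVertex k (fun x => w k 1 x * r k 0 x),
    ← N.sum_ξ_mul_atVertex k (fun x => w k 0 x * r k 1 x), ← Finset.sum_add_distrib,
    Finset.mul_sum]
  refine Finset.sum_congr rfl fun v _ => ?_
  rw [atVertex_mul, atVertex_mul]
  ring

/-- At a junction the common pressure factors out of the Kirchhoff sum. At any other vertex, each
incident pipe has either zero pressure (entry) or zero flux (exit). -/
theorem sum_flux_mul_pressure_eq_zero {w r : Field m} (hw : N.VertexConditions w)
    (hr : N.VertexConditions r) (v : Fin n) :
    ∑ k, N.ξ k v * N.D k ^ 2 * (N.atVertex k v (w k 1) * N.atVertex k v (r k 0)) = 0 := by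
  by_cases hv : v ∈ N.interiorNodes
  · by_cases hk : ∃ k, N.ξ k v ≠ 0
    · obtain ⟨j, hj⟩ := hk
      have e : ∀ k, N.ξ k v * N.D k ^ 2 * (N.atVertex k v (w k 1) * N.atVertex k v (r k 0)) =
          N.ξ k v * N.D k ^ 2 * N.atVertex k v (w k 1) * N.atVertex j v (r j 0) := by
        intro k
        by_cases hk : N.ξ k v = 0
        · simp [hk]
        · rw [hr.pressure v hv j k hj hk]
          ring
      simp_rw [e]
      rw [← Finset.sum_mul, hw.kirchhoff v hv, zero_mul]
    · push Not at hk
      simp [hk]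
  · refine Finset.sum_eq_zero fun k _ => ?_
    by_cases hk : N.ξ k v = 0
    · simp [hk]
    rcases N.ξ_ne_zero_iff.1 hk with rfl | rfl
    · rw [atVertex_src, atVertex_src, hr.entry k (N.src_mem_entryNodes hv)]
      simp
    · rw [atVertex_tgt, atVertex_tgt, hw.exit k (N.tgt_mem_exitNodes hv)]
      simp

theorem boundaryForm_eq_zero {w r : Field m} (hw : N.VertexConditions w)
    (hr : N.VertexConditions r) : N.boundaryForm w r = 0 := by
  unfold boundaryForm
  refine Finset.sum_eq_zero fun v _ => ?_
  simp_rw [mul_add]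
  rw [Finset.sum_add_distrib, N.sum_flux_mul_pressure_eq_zero hw hr, zero_add,
    ← N.sum_flux_mul_pressure_eq_zero hr hw v]
  exact Finset.sum_congr rfl fun k _ => by ring

/-- The field interpolating linearly between prescribed values at the vertices. -/
def interp (τ : Fin m → Fin 2 → Fin n → ℝ) : Field m := fun k i x =>
  τ k i (N.src k) + x * ((τ k i (N.tgt k) - τ k i (N.src k)) / N.L k)

theorem atVertex_interp (τ : Fin m → Fin 2 → Fin n → ℝ) {k : Fin m} (i : Fin 2) {v : Fin n}
    (h : N.ξ k v ≠ 0) : N.atVertex k v (N.interp τ k i) = τ k i v := by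
  rcases N.ξ_ne_zero_iff.1 h with rfl | rfl
  · simp [atVertex_src, interp]
  · have := (N.L_pos k).ne'
    rw [atVertex_tgt, interp]
    field_simp
    ring

theorem interp_isH1On (τ : Fin m → Fin 2 → Fin n → ℝ) (k : Fin m) (i : Fin 2) :
    IsH1On 0 (N.L k) (N.interp τ k i)
      fun _ => (τ k i (N.tgt k) - τ k i (N.src k)) / N.L k := by
  refine ⟨memLp_const _, fun x _ => ?_⟩
  rw [intervalIntegral.integral_const, sub_zero, smul_eq_mul]
  simp [interp]

/-- Fields that are orthogonal to the linear interpolations in `𝒟(𝔸)` with respect to the boundary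
form satisfy the vertex conditions. -/
theorem vertexConditions_of_boundaryForm {w : Field m}
    (h : ∀ τ, N.VertexConditions (N.interp τ) → N.boundaryForm w (N.interp τ) = 0) :
    N.VertexConditions w := by
  -- Localization at `v`: interpolate pressure `a` and fluxes `b k` at `v` and zero at all other
  -- vertices. The three premises say that this test field satisfies the vertex conditions.
  have key : ∀ (v : Fin n) (a : ℝ) (b : Fin m → ℝ), (v ∈ N.entryNodes → a = 0) →
      (∀ k, N.tgt k = v → v ∈ N.exitNodes → b k = 0) →
      (v ∈ N.interiorNodes → ∑ k, N.ξ k v * N.D k ^ 2 * b k = 0) →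
      ∑ k, N.ξ k v * N.D k ^ 2 *
        (N.atVertex k v (w k 1) * a + N.atVertex k v (w k 0) * b k) = 0 := by
    intro v a b h1 h2 h3
    let τ : Fin m → Fin 2 → Fin n → ℝ := fun k i u => if u = v then ![a, b k] i else 0
    have hval : ∀ k i, ∀ u, N.ξ k u ≠ 0 → N.atVertex k u (N.interp τ k i) =
        if u = v then ![a, b k] i else 0 := fun k i u hu => N.atVertex_interp τ i hu
    have hτ : N.VertexConditions (N.interp τ) := by
      refine ⟨?_, ?_, ?_, ?_⟩
      · intro k hk
        have := hval k 0 (N.src k) (by rw [ξ_src]; norm_num)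
        rw [atVertex_src] at this
        rw [this]
        split_ifs with hv
        · simpa using h1 (hv ▸ hk)
        · rfl
      · intro k hk
        have := hval k 1 (N.tgt k) (by rw [ξ_tgt]; norm_num)
        rw [atVertex_tgt] at this
        rw [this]
        split_ifs with hv
        · simpa using h2 k hv (hv ▸ hk)
        · rfl
      · intro u hu j k hj hk
        rw [hval j 0 u hj, hval k 0 u hk]
        simp
      · intro u hu
        by_cases huv : u = v
        · subst huv
          rw [← h3 hu]
          refine Finset.sum_congr rfl fun k _ => ?_
          by_cases hk : N.ξ k u = 0
          · simp [hk]
          · rw [hval k 1 u hk]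
            simp
        · refine Finset.sum_eq_zero fun k _ => ?_
          by_cases hk : N.ξ k u = 0
          · simp [hk]
          · rw [hval k 1 u hk]
            simp [huv]
    have h4 := h τ hτ
    unfold boundaryForm at h4
    rw [Finset.sum_eq_single v] at h4
    · rw [← h4]
      refine Finset.sum_congr rfl fun k _ => ?_
      by_cases hk : N.ξ k v = 0
      · simp [hk]
      · rw [hval k 0 v hk, hval k 1 v hk]
        simp
    · intro u _ huv
      refine Finset.sum_eq_zero fun k _ => ?_
      by_cases hk : N.ξ k u = 0
      · simp [hk]
      · rw [hval k 0 u hk, hval k 1 u hk]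
        simp [huv]
    · simp
  have hD : ∀ k, N.D k ^ 2 ≠ 0 := fun k => pow_ne_zero 2 (N.D_pos k).ne'
  refine ⟨?_, ?_, ?_, ?_⟩
  · intro k hk
    -- At an entry the flux is free, and a unit test flux reads off the pressure.
    have h1 := key (N.src k) 0 (fun j => if j = k then 1 else 0) (fun _ => rfl) ?_
      (fun h => absurd h hk.1)
    · rw [Finset.sum_eq_single k] at h1
      · simpa [ξ_src, atVertex_src, (N.D_pos k).ne'] using h1
      · intro j _ hj
        simp [hj]
      · simp
    · intro j hj _
      rw [if_neg]
      rintro rfl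
      exact N.no_loop j hj.symm
  · intro k hk
    -- At an exit the pressure is free, and a unit test pressure reads off the flux.
    have h1 := key (N.tgt k) 1 (fun j => 0) (fun h => absurd h N.tgt_notMem_entryNodes)
      (fun _ _ _ => rfl) (fun h => absurd h hk.1)
    rw [Finset.sum_eq_single k] at h1
    · simpa [ξ_tgt, atVertex_tgt, (N.D_pos k).ne'] using h1
    · intro j _ hj
      have : N.ξ j (N.tgt k) = 0 := by
        by_contra hne
        exact hj (N.eq_of_notMem_interiorNodes hk.1 hne (by rw [ξ_tgt]; norm_num))
      simp [this]
    · simp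
  · intro v hv j k hj hk
    -- Opposite normalized test fluxes on pipes `j` and `k`, with `ξ ^ 2 = 1`: taking `c = 1` shows
    -- that they balance, and taking the pressures for `c` yields their difference.
    have hsum : ∀ c : Fin m → ℝ, ∑ l, N.ξ l v * N.D l ^ 2 * (c l *
        ((if l = j then N.ξ j v / N.D j ^ 2 else 0) - if l = k then N.ξ k v / N.D k ^ 2 else 0)) =
        c j - c k := by
      intro c
      simp_rw [mul_sub]
      rw [Finset.sum_sub_distrib, Finset.sum_eq_single j, Finset.sum_eq_single k]
      · have hj' := N.ξ_mul_self hj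
        have hk' := N.ξ_mul_self hk
        have := (N.D_pos j).ne'
        have := (N.D_pos k).ne'
        simp only [if_true]
        congr 1
        · field_simp
          linear_combination c j * hj'
        · field_simp
          linear_combination c k * hk'
      all_goals simp +contextual
    have h1 := key v 0 (fun l => (if l = j then N.ξ j v / N.D j ^ 2 else 0) -
      if l = k then N.ξ k v / N.D k ^ 2 else 0) (fun _ => rfl) (fun _ _ h => absurd hv h.1)
      fun _ => by simpa using hsum fun _ => 1
    simp only [mul_zero, zero_add] at h1
    rw [hsum fun l => N.atVertex l v (w l 0)] at h1
    exact sub_eq_zero.1 h1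
  · intro v hv
    -- A unit pressure at the junction, without flux, turns the boundary form into the Kirchhoff
    -- sum.
    have h1 := key v 1 (fun _ => 0) (fun h => absurd hv h.1) (fun _ _ _ => rfl) (fun _ => by simp)
    simpa using h1

/-! ### Inner products -/

theorem μ_eq (k : Fin m) (i : Fin 2) :
    N.μ (k, i) = ENNReal.ofReal (N.D k ^ 2 * if i = 0 then 1 else N.c ^ 2) •
      volume.restrict (Ioo 0 (N.L k)) := rfl

theorem weight_pos (k : Fin m) (i : Fin 2) : 0 < N.D k ^ 2 * if i = 0 then 1 else N.c ^ 2 := by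
  have h1 := N.D_pos k
  have h2 := N.c_pos
  split_ifs <;> positivity

/-- The weights are positive constants, so almost everywhere statements may be made with respect to
Lebesgue measure. -/
theorem ae_μ (k : Fin m) (i : Fin 2) :
    ae (N.μ (k, i)) = ae (volume.restrict (Ioo 0 (N.L k))) := by
  rw [μ_eq, Measure.ae_ennreal_smul_measure_eq]
  exact (ENNReal.ofReal_pos.2 (N.weight_pos k i)).ne'

theorem memLp_μ_iff {f : ℝ → ℝ} (k : Fin m) (i : Fin 2) :
    MemLp f 2 (N.μ (k, i)) ↔ MemLp f 2 (volume.restrict (Ioo 0 (N.L k))) := by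
  have h := (ENNReal.ofReal_pos.2 (N.weight_pos k i)).ne'
  constructor
  · intro hf
    have := hf.smul_measure (c := (ENNReal.ofReal (N.D k ^ 2 * if i = 0 then 1 else N.c ^ 2))⁻¹)
      (ENNReal.inv_ne_top.2 h)
    rwa [μ_eq, smul_smul, ENNReal.inv_mul_cancel h ENNReal.ofReal_ne_top, one_smul] at this
  · intro hf
    exact hf.smul_measure ENNReal.ofReal_ne_top

theorem toL2_coeFn {w : Field m} {k : Fin m} {i : Fin 2}
    (h : MemLp (w k i) 2 (volume.restrict (Ioo 0 (N.L k)))) :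
    N.toL2 w (k, i) =ᵐ[volume.restrict (Ioo 0 (N.L k))] w k i := by
  have h' := (N.memLp_μ_iff k i).2 h
  have e : N.toL2 w (k, i) = h'.toLp := by
    simp only [toL2]
    exact dif_pos h'
  rw [e, ← N.ae_μ k i]
  exact h'.coeFn_toLp

theorem memLp_coeFn (u : N.L2) (k : Fin m) (i : Fin 2) :
    MemLp (u (k, i)) 2 (volume.restrict (Ioo 0 (N.L k))) :=
  (N.memLp_μ_iff k i).1 (Lp.memLp _)

theorem inner_eq {u z : N.L2} {w r : Field m}
    (hu : ∀ k i, u (k, i) =ᵐ[volume.restrict (Ioo 0 (N.L k))] w k i)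
    (hz : ∀ k i, z (k, i) =ᵐ[volume.restrict (Ioo 0 (N.L k))] r k i) :
    inner ℝ u z = ∑ k, N.D k ^ 2 * ((∫ x in 0..N.L k, w k 0 x * r k 0 x) +
      N.c ^ 2 * ∫ x in 0..N.L k, w k 1 x * r k 1 x) := by
  have e : ∀ k i, inner ℝ (u (k, i)) (z (k, i)) =
      (N.D k ^ 2 * if i = 0 then 1 else N.c ^ 2) * ∫ x in 0..N.L k, w k i x * r k i x := by
    intro k i
    have h : (fun x => inner ℝ (u (k, i) x) (z (k, i) x)) =ᵐ[N.μ (k, i)]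
        fun x => w k i x * r k i x := by
      filter_upwards [(N.ae_μ k i).symm ▸ hu k i, (N.ae_μ k i).symm ▸ hz k i] with x h1 h2
      rw [← h1, ← h2, real_inner_comm]
      rfl
    rw [L2.inner_def, integral_congr_ae h, μ_eq, integral_smul_measure,
      ENNReal.toReal_ofReal (N.weight_pos k i).le, smul_eq_mul,
      intervalIntegral.integral_of_le (N.L_pos k).le, integral_Ioc_eq_integral_Ioo]
  rw [PiLp.inner_apply, Fintype.sum_prod_type]
  refine Finset.sum_congr rfl fun k _ => ?_
  rw [Fin.sum_univ_two, e, e]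
  simp
  ring

/-! ### Skew-adjointness of `𝔸` -/

theorem ae_eq_μ_iff {f g : ℝ → ℝ} (k : Fin m) (i : Fin 2) :
    f =ᵐ[N.μ (k, i)] g ↔ f =ᵐ[volume.restrict (Ioo 0 (N.L k))] g := by
  unfold Filter.EventuallyEq
  rw [N.ae_μ k i]

theorem opA_iff {u z : N.L2} : N.opA u z ↔ ∃ w w' : Field m,
    (∀ k i, IsH1On 0 (N.L k) (w k i) (w' k i)) ∧
    (∀ k i, u (k, i) =ᵐ[volume.restrict (Ioo 0 (N.L k))] w k i) ∧
    N.VertexConditions w ∧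
    ∀ k i, z (k, i) =ᵐ[volume.restrict (Ioo 0 (N.L k))]
      (![fun x => -N.c ^ 2 * w' k 1 x, fun x => -w' k 0 x] : Fin 2 → ℝ → ℝ) i := by
  constructor
  · rintro ⟨w, w', h1, h2, h3, h4, h5, h6, h7⟩
    refine ⟨w, w', h1, fun k i => (N.ae_eq_μ_iff k i).1 (h2 k i), ⟨h3, h4, h5, h6⟩, fun k i => ?_⟩
    rw [← N.ae_eq_μ_iff k i]
    fin_cases i
    · exact (h7 k).1
    · exact (h7 k).2
  · rintro ⟨w, w', h1, h2, h3, h4⟩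
    exact ⟨w, w', h1, fun k i => (N.ae_eq_μ_iff k i).2 (h2 k i), h3.entry, h3.exit, h3.pressure,
      h3.kirchhoff, fun k => ⟨(N.ae_eq_μ_iff k 0).2 (h4 k 0), (N.ae_eq_μ_iff k 1).2 (h4 k 1)⟩⟩

/-- Every field in `ℍ¹(Ω)` satisfying the vertex conditions defines an element of the graph. -/
theorem opA_toL2 {w w' : Field m} (h : ∀ k i, IsH1On 0 (N.L k) (w k i) (w' k i))
    (hw : N.VertexConditions w) :
    N.opA (N.toL2 w) (N.toL2 fun k => ![fun x => -N.c ^ 2 * w' k 1 x, fun x => -w' k 0 x]) := by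
  refine N.opA_iff.2 ⟨w, w', h, fun k i => N.toL2_coeFn ((h k i).memLp (N.L_pos k).le), hw,
    fun k i => ?_⟩
  refine N.toL2_coeFn (w := fun k => ![fun x => -N.c ^ 2 * w' k 1 x, fun x => -w' k 0 x]) ?_
  fin_cases i
  · exact (h k 1).1.const_mul _
  · exact (h k 0).1.neg

/-- Green's formula for `𝔸`. -/
theorem inner_add_inner_eq_boundaryForm {u y u' y' : N.L2} {w w' r r' : Field m}
    (hw : ∀ k i, IsH1On 0 (N.L k) (w k i) (w' k i)) (hr : ∀ k i, IsH1On 0 (N.L k) (r k i) (r' k i))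
    (hu : ∀ k i, u (k, i) =ᵐ[volume.restrict (Ioo 0 (N.L k))] w k i)
    (hy : ∀ k i, y (k, i) =ᵐ[volume.restrict (Ioo 0 (N.L k))]
      (![fun x => -N.c ^ 2 * w' k 1 x, fun x => -w' k 0 x] : Fin 2 → ℝ → ℝ) i)
    (hu' : ∀ k i, u' (k, i) =ᵐ[volume.restrict (Ioo 0 (N.L k))] r k i)
    (hy' : ∀ k i, y' (k, i) =ᵐ[volume.restrict (Ioo 0 (N.L k))]
      (![fun x => -N.c ^ 2 * r' k 1 x, fun x => -r' k 0 x] : Fin 2 → ℝ → ℝ) i) :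
    inner ℝ y u' + inner ℝ u y' = -N.c ^ 2 * N.boundaryForm w r := by
  rw [N.inner_eq (w := fun k => ![fun x => -N.c ^ 2 * w' k 1 x, fun x => -w' k 0 x]) hy hu',
    N.inner_eq (r := fun k => ![fun x => -N.c ^ 2 * r' k 1 x, fun x => -r' k 0 x]) hu hy',
    boundaryForm_eq, ← Finset.sum_add_distrib, Finset.mul_sum]
  refine Finset.sum_congr rfl fun k _ => ?_
  have hL := (N.L_pos k).le
  rw [← (hw k 1).integral_parts hL (hr k 0), ← (hw k 0).integral_parts hL (hr k 1),
    intervalIntegral.integral_add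
      (integrable_mul_of_memLp_two hL (hw k 1).1 ((hr k 0).memLp hL))
      (integrable_mul_of_memLp_two hL ((hw k 1).memLp hL) (hr k 0).1),
    intervalIntegral.integral_add
      (integrable_mul_of_memLp_two hL (hw k 0).1 ((hr k 1).memLp hL))
      (integrable_mul_of_memLp_two hL ((hw k 0).memLp hL) (hr k 1).1)]
  -- The weight `c ^ 2` of the flux component matches the factor in `𝔸`: all four integrals carry
  -- `-c ^ 2` and pair into two exact derivatives.
  have e1 : ∀ x, w k 0 x * (-N.c ^ 2 * r' k 1 x) = -N.c ^ 2 * (w k 0 x * r' k 1 x) :=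
    fun x => by ring
  have e2 : ∀ x, -N.c ^ 2 * w' k 1 x * r k 0 x = -N.c ^ 2 * (w' k 1 x * r k 0 x) :=
    fun x => by ring
  simp only [Matrix.cons_val_zero, Matrix.cons_val_one, e1, e2, neg_mul (w' k 0 _),
    mul_neg (w k 1 _), intervalIntegral.integral_const_mul, intervalIntegral.integral_neg]
  ring

/-- Changing one component on one pipe. -/
def singleField (k : Fin m) (i : Fin 2) (f : ℝ → ℝ) : Field m := Pi.single k (Pi.single i f)

theorem singleField_isH1On {k : Fin m} (i : Fin 2) {Q φ : ℝ → ℝ} (h : IsH1On 0 (N.L k) Q φ)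
    (l : Fin m) (j : Fin 2) :
    IsH1On 0 (N.L l) (singleField k i Q l j) (singleField k i φ l j) := by
  have h0 : IsH1On 0 (N.L l) 0 0 := ⟨MemLp.zero, fun x _ => by simp⟩
  unfold singleField
  by_cases hl : l = k
  · subst hl
    by_cases hj : j = i
    · subst hj
      simpa using h
    · simpa [hj] using h0
  · simpa [hl] using h0

theorem singleField_vertexConditions {k : Fin m} (i : Fin 2) {Q : ℝ → ℝ} (h0 : Q 0 = 0)
    (hL : Q (N.L k) = 0) : N.VertexConditions (singleField k i Q) := by
  have h1 : ∀ l j, singleField k i Q l j 0 = 0 ∧ singleField k i Q l j (N.L l) = 0 := by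
    intro l j
    unfold singleField
    by_cases hl : l = k
    · subst hl
      by_cases hj : j = i
      · subst hj
        simp [h0, hL]
      · simp [hj]
    · simp [hl]
  have h2 : ∀ l j v, N.atVertex l v (singleField k i Q l j) = 0 := by
    intro l j v
    unfold atVertex
    split_ifs
    · exact (h1 l j).1
    · exact (h1 l j).2
  refine ⟨fun l _ => (h1 l 0).1, fun l _ => (h1 l 1).2, ?_, ?_⟩
  · intro v _ j l _ _
    rw [h2, h2]
  · intro v _
    simp [h2]

/-- `𝔸 ⊆ -𝔸*` is Green's formula with a vanishing boundary form. For the converse, tests vanishing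
at the ends of one pipe give `ℍ¹` regularity and the form of `y`; Green's formula then leaves only
the boundary form, and interpolating tests give the vertex conditions. -/
theorem isSkewAdjointGraph_opA : IsSkewAdjointGraph N.opA where
  eq_zero z hz := by
    obtain ⟨w, w', h1, h2, -, h4⟩ := N.opA_iff.1 hz
    have hw' : ∀ k i, w' k i =ᵐ[volume.restrict (Ioo 0 (N.L k))] 0 := by
      intro k i
      refine (h1 k i).deriv_ae_eq_zero (N.L_pos k) ((h2 k i).symm.trans ?_)
      rw [← N.ae_eq_μ_iff k i]
      exact Lp.coeFn_zero ℝ 2 (N.μ (k, i))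
    refine PiLp.ext ?_
    rintro ⟨k, i⟩
    refine (Lp.eq_zero_iff_ae_eq_zero).2 ?_
    rw [N.ae_eq_μ_iff k i]
    refine (h4 k i).trans ?_
    fin_cases i
    · filter_upwards [hw' k 1] with x hx
      simp [hx]
    · filter_upwards [hw' k 0] with x hx
      simp [hx]
  mem_iff z y := by
    constructor
    · intro h u' y' h'
      obtain ⟨w, w', h1, h2, h3, h4⟩ := N.opA_iff.1 h
      obtain ⟨r, r', h1', h2', h3', h4'⟩ := N.opA_iff.1 h'
      have := N.inner_add_inner_eq_boundaryForm h1 h1' h2 h4 h2' h4'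
      rw [N.boundaryForm_eq_zero h3 h3', mul_zero] at this
      linarith
    · intro h
      have hc : N.c ^ 2 ≠ 0 := pow_ne_zero 2 N.c_pos.ne'
      have hz : ∀ k i, MemLp (z (k, i)) 2 (volume.restrict (Ioo 0 (N.L k))) := N.memLp_coeFn z
      have hy : ∀ k i, MemLp (y (k, i)) 2 (volume.restrict (Ioo 0 (N.L k))) := N.memLp_coeFn y
      have hrefl : ∀ (u : N.L2) k i, u (k, i) =ᵐ[volume.restrict (Ioo 0 (N.L k))]
          (fun k i => u (k, i) : Field m) k i := fun _ _ _ => ae_eq_refl _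
      have test : ∀ (k : Fin m) (i : Fin 2) (Q φ : ℝ → ℝ), IsH1On 0 (N.L k) Q φ → Q 0 = 0 →
          Q (N.L k) = 0 → ∑ l, N.D l ^ 2 *
            ((∫ x in 0..N.L l, y (l, 0) x * singleField k i Q l 0 x) +
              N.c ^ 2 * ∫ x in 0..N.L l, y (l, 1) x * singleField k i Q l 1 x) =
          -∑ l, N.D l ^ 2 *
            ((∫ x in 0..N.L l, z (l, 0) x * (-N.c ^ 2 * singleField k i φ l 1 x)) +
              N.c ^ 2 * ∫ x in 0..N.L l, z (l, 1) x * (-singleField k i φ l 0 x)) := by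
        intro k i Q φ hQ hQ0 hQL
        have hH1 := N.singleField_isH1On i hQ
        have h1 := N.opA_toL2 hH1 (N.singleField_vertexConditions i hQ0 hQL)
        have h2 := h _ _ h1
        rw [N.inner_eq (hrefl y) fun l j => N.toL2_coeFn ((hH1 l j).memLp (N.L_pos l).le),
          N.inner_eq (hrefl z) fun l j => N.toL2_coeFn ?_] at h2
        · exact h2
        · fin_cases j
          · exact (hH1 l 1).1.const_mul _
          · exact (hH1 l 0).1.neg
      have hF0 : ∀ k, ∃ F, IsH1On 0 (N.L k) F (fun x => -y (k, 1) x) ∧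
          z (k, 0) =ᵐ[volume.restrict (Ioo 0 (N.L k))] F := by
        intro k
        refine exists_isH1On_of_weak_deriv (N.L_pos k) (hz k 0) (hy k 1) fun Q φ hQ hQ0 hQL => ?_
        -- A test in the flux component involves `φ` only against the pressure of `z`, so it
        -- determines the pressure derivative; the roles are swapped for `hF1`.
        have h1 := test k 1 Q φ hQ hQ0 hQL
        rw [Finset.sum_eq_single k, Finset.sum_eq_single k] at h1
        · have e : ∀ x, z (k, 0) x * (-N.c ^ 2 * φ x) = -N.c ^ 2 * (z (k, 0) x * φ x) :=
            fun x => by ring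
          simp only [singleField, Pi.single_eq_same, ne_eq, zero_ne_one, not_false_eq_true,
            Pi.single_eq_of_ne, Pi.zero_apply, mul_zero, neg_zero, intervalIntegral.integral_zero,
            zero_add, add_zero, e, intervalIntegral.integral_const_mul] at h1
          have hD : N.D k ^ 2 * N.c ^ 2 ≠ 0 :=
            mul_ne_zero (pow_ne_zero 2 (N.D_pos k).ne') hc
          refine mul_left_cancel₀ hD ?_
          linarith
        all_goals simp +contextual [singleField]
      have hF1 : ∀ k, ∃ F, IsH1On 0 (N.L k) F (fun x => -((N.c ^ 2)⁻¹ * y (k, 0) x)) ∧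
          z (k, 1) =ᵐ[volume.restrict (Ioo 0 (N.L k))] F := by
        intro k
        refine exists_isH1On_of_weak_deriv (N.L_pos k) (hz k 1) ((hy k 0).const_mul _)
          fun Q φ hQ hQ0 hQL => ?_
        have h1 := test k 0 Q φ hQ hQ0 hQL
        rw [Finset.sum_eq_single k, Finset.sum_eq_single k] at h1
        · simp only [singleField, Pi.single_eq_same, ne_eq, one_ne_zero, not_false_eq_true,
            Pi.single_eq_of_ne, Pi.zero_apply, mul_zero, intervalIntegral.integral_zero,
            zero_add, add_zero, mul_neg, intervalIntegral.integral_neg] at h1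
          have hD : N.D k ^ 2 * N.c ^ 2 ≠ 0 :=
            mul_ne_zero (pow_ne_zero 2 (N.D_pos k).ne') hc
          refine mul_left_cancel₀ hD ?_
          simp only [mul_assoc, intervalIntegral.integral_const_mul]
          rw [mul_inv_cancel_left₀ hc]
          linarith
        all_goals simp +contextual [singleField]
      choose F0 hF0 hzF0 using hF0
      choose F1 hF1 hzF1 using hF1
      let w : Field m := fun k => ![F0 k, F1 k]
      let w' : Field m := fun k => ![fun x => -y (k, 1) x, fun x => -((N.c ^ 2)⁻¹ * y (k, 0) x)]
      have hw : ∀ k i, IsH1On 0 (N.L k) (w k i) (w' k i) := by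
        intro k i
        fin_cases i
        · exact hF0 k
        · exact hF1 k
      have hzw : ∀ k i, z (k, i) =ᵐ[volume.restrict (Ioo 0 (N.L k))] w k i := by
        intro k i
        fin_cases i
        · exact hzF0 k
        · exact hzF1 k
      have hyw : ∀ k i, y (k, i) =ᵐ[volume.restrict (Ioo 0 (N.L k))]
          (![fun x => -N.c ^ 2 * w' k 1 x, fun x => -w' k 0 x] : Fin 2 → ℝ → ℝ) i := by
        intro k i
        refine Eventually.of_forall fun x => ?_
        fin_cases i
        · simp [w', mul_inv_cancel_left₀ hc]
        · simp [w']
      refine N.opA_iff.2 ⟨w, w', hw, hzw, N.vertexConditions_of_boundaryForm fun τ hτ => ?_, hyw⟩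
      have hr := N.interp_isH1On τ
      have h1 := N.inner_add_inner_eq_boundaryForm hw hr hzw hyw
        (fun k i => N.toL2_coeFn ((hr k i).memLp (N.L_pos k).le))
        (fun k i => N.toL2_coeFn
          (w := fun k => ![fun x => -N.c ^ 2 * ((τ k 1 (N.tgt k) - τ k 1 (N.src k)) / N.L k),
            fun x => -((τ k 0 (N.tgt k) - τ k 0 (N.src k)) / N.L k)]) (by
          fin_cases i
          · exact memLp_const _
          · exact memLp_const _))
      rw [h _ _ (N.opA_toL2 hr hτ), neg_add_cancel] at h1
      have hc' : -N.c ^ 2 ≠ 0 := neg_ne_zero.2 hc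
      exact (mul_eq_zero.1 h1.symm).resolve_left hc'

end Network

/-! ### Continuous dependence of the coefficients on time -/

namespace Network

variable {m n : ℕ} (N : Network m n)

/-- The measures of the two components on a pipe are proportional, and a continuous coefficient is
bounded on the compact pipe. -/
theorem mulBounded {a : ℝ → ℝ} {k : Fin m} (l i : Fin 2) (ha : ContinuousOn a (Icc 0 (N.L k))) :
    MulBounded (N.μ (k, l)) (N.μ (k, i)) a := by
  constructor
  · obtain ⟨C, hC⟩ := isCompact_Icc.exists_bound_of_continuousOn ha
    have h1 : AEStronglyMeasurable a (volume.restrict (Ioo 0 (N.L k))) :=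
      (ha.mono Ioo_subset_Icc_self).aestronglyMeasurable measurableSet_Ioo
    have hac : N.μ (k, i) ≪ volume.restrict (Ioo 0 (N.L k)) := by
      rw [μ_eq]
      exact Measure.smul_absolutelyContinuous
    refine memLp_top_of_bound (h1.mono_ac hac) C ?_
    rw [N.ae_μ]
    exact (ae_restrict_iff' measurableSet_Ioo).2
      (Eventually.of_forall fun x hx => hC x (Ioo_subset_Icc_self hx))
  · have hi := N.weight_pos k i
    have hl := N.weight_pos k l
    refine ⟨Real.toNNReal ((N.D k ^ 2 * if i = 0 then 1 else N.c ^ 2) /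
      (N.D k ^ 2 * if l = 0 then 1 else N.c ^ 2)), le_of_eq ?_⟩
    change _ = ENNReal.ofReal _ • (N.μ (k, l))
    rw [μ_eq, μ_eq, smul_smul, ← ENNReal.ofReal_mul (div_nonneg hi.le hl.le),
      div_mul_cancel₀ _ hl.ne']

theorem norm_mulOp_self_le {a : ℝ → ℝ} {k : Fin m} (l : Fin 2)
    (ha : ContinuousOn a (Icc 0 (N.L k))) {M : ℝ} (hM0 : 0 ≤ M)
    (hM : ∀ x ∈ Icc 0 (N.L k), |a x| ≤ M) : ‖mulOp (N.μ (k, l)) (N.μ (k, l)) a‖ ≤ M := by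
  refine ContinuousLinearMap.opNorm_le_bound _ hM0 fun f => ?_
  refine Lp.norm_le_mul_norm_of_ae_le_mul ?_
  have h : ∀ᵐ x ∂N.μ (k, l), |a x| ≤ M := by
    rw [N.ae_μ]
    exact (ae_restrict_iff' measurableSet_Ioo).2
      (Eventually.of_forall fun x hx => hM x (Ioo_subset_Icc_self hx))
  filter_upwards [mulOp_coeFn (N.mulBounded l l ha) f, h] with x h1 h2
  rw [h1, norm_mul]
  exact mul_le_mul_of_nonneg_right h2 (norm_nonneg _)

/-- Splitting off the fixed change of weight means that norm estimates are needed only between equal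
measures. -/
theorem mulOp_eq_comp {a : ℝ → ℝ} {k : Fin m} (l i : Fin 2) (ha : ContinuousOn a (Icc 0 (N.L k))) :
    mulOp (N.μ (k, l)) (N.μ (k, i)) a =
      (mulOp (N.μ (k, l)) (N.μ (k, i)) fun _ => 1).comp (mulOp (N.μ (k, l)) (N.μ (k, l)) a) := by
  refine ContinuousLinearMap.ext fun f => Lp.ext ?_
  refine (mulOp_coeFn (N.mulBounded l i ha) f).trans (EventuallyEq.symm ?_)
  refine (mulOp_coeFn (N.mulBounded l i continuousOn_const) _).trans ?_
  have h := mulOp_coeFn (N.mulBounded l l ha) f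
  rw [N.ae_eq_μ_iff] at h ⊢
  filter_upwards [h] with x hx
  exact (one_mul _).trans hx

theorem mulOp_sub {a b : ℝ → ℝ} {k : Fin m} (l i : Fin 2) (ha : ContinuousOn a (Icc 0 (N.L k)))
    (hb : ContinuousOn b (Icc 0 (N.L k))) :
    mulOp (N.μ (k, l)) (N.μ (k, i)) a - mulOp (N.μ (k, l)) (N.μ (k, i)) b =
      mulOp (N.μ (k, l)) (N.μ (k, i)) fun x => a x - b x := by
  refine ContinuousLinearMap.ext fun f => Lp.ext ?_
  rw [sub_apply]
  refine (Lp.coeFn_sub _ _).trans ?_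
  filter_upwards [mulOp_coeFn (N.mulBounded l i ha) f, mulOp_coeFn (N.mulBounded l i hb) f,
    mulOp_coeFn (N.mulBounded l i (ha.sub hb)) f] with x h1 h2 h3
  rw [Pi.sub_apply, h1, h2, ← sub_mul]
  exact h3.symm

/-- Uniform continuity on the compact product makes the coefficients converge uniformly on the pipe,
hence the operators converge in norm. -/
theorem continuousOn_mulOp {s : Set ℝ} (hs : IsCompact s) {a : ℝ → ℝ → ℝ} {k : Fin m} (l i : Fin 2)
    (ha : ContinuousOn (Function.uncurry a) (s ×ˢ Icc 0 (N.L k))) :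
    ContinuousOn (fun t => mulOp (N.μ (k, l)) (N.μ (k, i)) (a t)) s := by
  have hat : ∀ t ∈ s, ContinuousOn (a t) (Icc 0 (N.L k)) := fun t ht =>
    ha.comp (f := fun x => (t, x)) (by fun_prop) fun x hx => ⟨ht, hx⟩
  have h1 : ContinuousOn (fun t => mulOp (N.μ (k, l)) (N.μ (k, l)) (a t)) s := by
    have hu := (hs.prod isCompact_Icc).uniformContinuousOn_of_continuous ha
    rw [Metric.uniformContinuousOn_iff_le] at hu
    rw [Metric.continuousOn_iff]
    intro t ht ε hε
    obtain ⟨δ, hδ, h⟩ := hu (ε / 2) (by positivity)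
    refine ⟨δ, hδ, fun r hr hrt => ?_⟩
    rw [dist_eq_norm, N.mulOp_sub l l (hat r hr) (hat t ht)]
    refine (N.norm_mulOp_self_le l ((hat r hr).sub (hat t ht)) (by positivity) fun x hx => ?_).trans_lt
      (half_lt_self hε)
    refine h (r, x) ⟨hr, hx⟩ (t, x) ⟨ht, hx⟩ ?_
    rw [Prod.dist_eq, dist_self]
    exact max_le hrt.le hδ.le
  refine ((continuousOn_const (c := mulOp (N.μ (k, l)) (N.μ (k, i)) fun _ => 1)).clm_comp
    h1).congr fun t ht => ?_
  exact N.mulOp_eq_comp l i (hat t ht)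

theorem continuousOn_matrixOp {s : Set ℝ} (hs : IsCompact s)
    {M : ℝ → Fin m → Fin 2 → Fin 2 → ℝ → ℝ}
    (hM : ∀ k i l, ContinuousOn (fun p : ℝ × ℝ => M p.1 k i l p.2) (s ×ˢ Icc 0 (N.L k))) :
    ContinuousOn (fun t => N.matrixOp (M t)) s := by
  unfold matrixOp
  refine continuousOn_const.clm_comp ?_
  refine (ContinuousLinearMap.piEquivL ℝ N.L2 fun j => Lp ℝ 2 (N.μ j)).continuous.comp_continuousOn
    (continuousOn_pi.2 ?_)
  rintro ⟨k, i⟩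
  exact continuousOn_finsetSum _ fun l _ => (N.continuousOn_mulOp hs
    (a := fun t x => M t k i l x) l i (hM k i l)).clm_comp continuousOn_const

/-- A component is the image of the constant `1` under multiplication by itself, so continuity of
the multiplication operators suffices. -/
theorem continuousOn_toL2 {s : Set ℝ} (hs : IsCompact s) {w : ℝ → Field m}
    (hw : ∀ k i, ContinuousOn (fun p : ℝ × ℝ => w p.1 k i p.2) (s ×ˢ Icc 0 (N.L k))) :
    ContinuousOn (fun t => N.toL2 (w t)) s := by
  have hwt : ∀ t ∈ s, ∀ k i, ContinuousOn (w t k i) (Icc 0 (N.L k)) := fun t ht k i =>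
    (hw k i).comp (f := fun x => (t, x)) (by fun_prop) fun x hx => ⟨ht, hx⟩
  have hone : ∀ k i, MemLp (fun _ => (1 : ℝ)) 2 (N.μ (k, i)) := fun k i =>
    (N.memLp_μ_iff k i).2 (memLp_const 1)
  have key : ∀ t ∈ s, ∀ k i,
      N.toL2 (w t) (k, i) = mulOp (N.μ (k, i)) (N.μ (k, i)) (w t k i) (hone k i).toLp := by
    intro t ht k i
    refine Lp.ext ?_
    have h1 := N.toL2_coeFn (memLp_of_continuousOn (hwt t ht k i))
    rw [← N.ae_eq_μ_iff k i] at h1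
    filter_upwards [h1, mulOp_coeFn (N.mulBounded i i (hwt t ht k i)) (hone k i).toLp,
      (hone k i).coeFn_toLp] with x h1 h2 h3
    rw [h1, h2, h3, mul_one]
  refine (PiLp.continuous_toLp 2 _).comp_continuousOn (f := fun t => (N.toL2 (w t)).ofLp)
    (continuousOn_pi.2 ?_)
  rintro ⟨k, i⟩
  exact ((N.continuousOn_mulOp hs (a := fun t x => w t k i x) i i (hw k i)).clm_apply continuousOn_const).congr
    fun t ht => key t ht k i

theorem continuous_fieldAt {T : ℝ} (hT : 0 < T) (v : N.VT T) (k : Fin m) (i : Fin 2) :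
    Continuous fun p : ℝ × ℝ => N.fieldAt hT v p.1 k i p.2 := by
  have h1 : Continuous fun p : ℝ × ℝ => v (projIcc 0 T hT.le p.1) k i :=
    (continuous_apply i).comp ((continuous_apply k).comp
      (v.continuous.comp (continuous_projIcc.comp continuous_fst)))
  have h2 : Continuous fun p : ℝ × ℝ => projIcc 0 (N.L k) (N.L_pos k).le p.2 :=
    continuous_projIcc.comp continuous_snd
  exact h1.eval h2

theorem fieldAt_pressure_pos {pin qe : Fin m → ℝ} {K : Set (Fin m → Fin 2 → ℝ)}
    (hK : N.IsSuitable pin qe K) {T : ℝ} (hT : 0 < T) {v : N.VT T} (hv : v ∈ N.Vad T K)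
    (t : ℝ) (k : Fin m) (x : ℝ) : 0 < N.fieldAt hT v t k 0 x := by
  obtain ⟨⟨a, b, c, d, ha, -, rfl⟩, -⟩ := hK
  have h := hv (projIcc 0 T hT.le t)
    (fun j => projIcc 0 (N.L j) (N.L_pos j).le x) k
  exact (ha k).trans_le h.1.1

/-- Positive pressure keeps the quotients in the coefficients jointly continuous. Norm continuity
also passes to the adjoints, as the backward problem requires. -/
theorem continuousOn_frakF {pin qe : Fin m → ℝ} {K : Set (Fin m → Fin 2 → ℝ)}
    (hK : N.IsSuitable pin qe K) {T : ℝ} (hT : 0 < T) {v : N.VT T} (hv : v ∈ N.Vad T K) :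
    ContinuousOn (fun t => N.frakF (N.fieldAt hT v t)) (Icc 0 T) := by
  unfold frakF
  refine N.continuousOn_matrixOp isCompact_Icc fun k i l => Continuous.continuousOn ?_
  have hp := N.continuous_fieldAt hT v k 0
  have hq := N.continuous_fieldAt hT v k 1
  have hne : ∀ p : ℝ × ℝ, N.fieldAt hT v p.1 k 0 p.2 ≠ 0 := fun p =>
    (N.fieldAt_pressure_pos hK hT hv p.1 k p.2).ne'
  fin_cases i
  · fin_cases l
    · exact continuous_const
    · exact continuous_const
  · fin_cases l
    · exact continuous_const.mul ((hq.mul hq.abs).div (hp.pow 2) fun p => pow_ne_zero 2 (hne p))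
    · exact continuous_const.mul (hq.abs.div hp hne)

theorem continuousOn_opB {s : Set ℝ} (hs : IsCompact s) {φ φ' : ℝ → Fin m → Fin 2 → ℝ}
    (hφ : ∀ k i, ContinuousOn (fun t => φ t k i) s)
    (hφ' : ∀ k i, ContinuousOn (fun t => φ' t k i) s) :
    ContinuousOn (fun t => N.toL2 (N.B1 (φ t))) s ∧
      ContinuousOn (fun t => N.opB (φ t) (φ' t)) s := by
  have hfst : ∀ {ψ : ℝ → Fin m → Fin 2 → ℝ}, (∀ k i, ContinuousOn (fun t => ψ t k i) s) →
      ∀ k i, ContinuousOn (fun p : ℝ × ℝ => ψ p.1 k i) (s ×ˢ Icc 0 (N.L k)) := fun h k i =>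
    (h k i).comp continuousOn_fst fun p hp => hp.1
  have hB1 : ∀ {ψ : ℝ → Fin m → Fin 2 → ℝ}, (∀ k i, ContinuousOn (fun t => ψ t k i) s) →
      ContinuousOn (fun t => N.toL2 (N.B1 (ψ t))) s := by
    intro ψ hψ
    refine N.continuousOn_toL2 hs fun k i => ?_
    have h0 := hfst hψ k 0
    have h1 := hfst hψ k 1
    fin_cases i
    · exact ContinuousOn.mul (f := fun p : ℝ × ℝ => (N.L k - p.2) / N.L k) (by fun_prop) h0
    · exact ContinuousOn.mul (f := fun p : ℝ × ℝ => p.2 / N.L k) (by fun_prop) h1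
  have hB0 : ContinuousOn (fun t => N.toL2 (N.B0 (φ t))) s := by
    refine N.continuousOn_toL2 hs fun k i => ?_
    have h0 := hfst hφ k 0
    have h1 := hfst hφ k 1
    fin_cases i
    · exact continuousOn_const.mul h1
    · exact continuousOn_const.mul h0
  refine ⟨hB1 hφ, ?_⟩
  unfold opB
  exact (hB0.add (N.opP.continuous.comp_continuousOn (hB1 hφ))).sub (hB1 hφ')

end Network

/-! ### Independence of mild solutions from the chosen semigroup -/

section Duality

variable {H : Type*} [NormedAddCommGroup H] [InnerProductSpace ℝ H] [CompleteSpace H]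

/-- Both semigroups are adjoint to the same `S`, hence they coincide. -/
theorem C0Semigroup.op_eq_of_isGeneratedBy {S S₁ S₂ : C0Semigroup H} {B B' : H → H → Prop}
    (hS₁ : S₁.IsGeneratedBy B) (hS₂ : S₂.IsGeneratedBy B) (hS : S.IsGeneratedBy B')
    (hadj : ∀ x y x' y', B x y → B' x' y' → inner ℝ y x' = inner ℝ x y')
    (hd : Dense {x | ∃ y, B x y}) (hd' : Dense {x | ∃ y, B' x y}) (t : ℝ) (ht : 0 ≤ t) :
    S₁.op t = S₂.op t := by
  ext x
  refine ext_inner_right ℝ fun x' => ?_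
  rw [C0Semigroup.inner_op_eq hS₁ hS hadj hd hd' ht, C0Semigroup.inner_op_eq hS₂ hS hadj hd hd' ht]

omit [InnerProductSpace ℝ H] [CompleteSpace H] in
theorem IsMildBackward.eq_integral [NormedSpace ℝ H] {B : H → H → Prop} {S : C0Semigroup H}
    (huniq : ∀ S' : C0Semigroup H, S'.IsGeneratedBy B → ∀ t, 0 ≤ t → S'.op t = S.op t)
    {T : ℝ} {g : ℝ → H → H} {p : ℝ → H} (h : IsMildBackward B T g 0 p) {t : ℝ} (ht : t ∈ Icc 0 T) :
    p t = ∫ s in t..T, S.op (s - t) (g s (p s)) := by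
  obtain ⟨S', hS', h⟩ := h
  rw [(h t ht).2, map_zero, zero_add]
  refine intervalIntegral.integral_congr fun s hs => ?_
  rw [uIcc_of_le ht.2] at hs
  rw [huniq S' hS' _ (sub_nonneg.2 hs.1)]

end Duality

/-! ### The generators `𝔸 + ℙ` and `-𝔸 + ℙ*` -/

namespace Network

variable {m n : ℕ} (N : Network m n)

theorem dense_opForward : Dense {u | ∃ z, N.opForward u z} :=
  N.isSkewAdjointGraph_opA.dense_domain.mono fun _ h => h.elim fun y hy => ⟨_, y, hy, rfl⟩

theorem dense_opAdjoint : Dense {u | ∃ z, N.opAdjoint u z} :=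
  N.isSkewAdjointGraph_opA.dense_domain.mono fun _ h => h.elim fun y hy => ⟨_, y, hy, rfl⟩

theorem inner_opForward_eq {u z u' z' : N.L2} (h : N.opForward u z) (h' : N.opAdjoint u' z') :
    inner ℝ z u' = inner ℝ u z' := by
  obtain ⟨y, hy, rfl⟩ := h
  obtain ⟨y', hy', rfl⟩ := h'
  rw [inner_add_left, inner_add_right, inner_neg_right, ContinuousLinearMap.adjoint_inner_right,
    (N.isSkewAdjointGraph_opA.mem_iff u y).1 hy u' y' hy']

theorem exists_c0Semigroup_opForward : ∃ S : C0Semigroup N.L2, S.IsGeneratedBy N.opForward :=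
  N.isSkewAdjointGraph_opA.exists_c0Semigroup N.opP

/-- `-𝔸` is skew-adjoint as well, so the perturbation theorem applies with `ℙ*`. -/
theorem exists_c0Semigroup_opAdjoint : ∃ S : C0Semigroup N.L2, S.IsGeneratedBy N.opAdjoint := by
  obtain ⟨S, hS⟩ := N.isSkewAdjointGraph_opA.neg.exists_c0Semigroup
    (ContinuousLinearMap.adjoint N.opP)
  refine ⟨S, fun x z => Iff.trans ⟨?_, ?_⟩ (hS x z)⟩
  · rintro ⟨y, hy, rfl⟩
    exact ⟨-y, by rwa [neg_neg], rfl⟩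
  · rintro ⟨y, hy, rfl⟩
    exact ⟨-y, hy, by rw [neg_neg]⟩

end Network

end GasNetwork

end

theorem proposition3p2 {m n : ℕ} (N : GasNetwork.Network m n) (pin qe : Fin m → ℝ)
    (hss : N.IsSteadyData pin qe)
    (K K' : Set (Fin m → Fin 2 → ℝ)) (hK : N.IsSuitable pin qe K) (hK' : N.IsSuitable pin qe K')
    (κt κx η κU T : ℝ) (hκt : 0 < κt) (hκx : 0 < κx) (hη : 0 < η) (hκU : 0 < κU) (hT : 0 < T)
    (Φ : GasNetwork.Control m T) (hΦ : N.MemU0eta η κU Φ)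
    (v : N.VT T) (hv : N.IsStateOf pin qe hT K κt κx Φ v)
    (vd : N.VT T) (hvd : vd ∈ interior (N.Vad T K')) :
    (∃! p : C(Set.Icc (0 : ℝ) T, N.L2), N.IsAdjointState hT v vd p) ∧
    ∀ h : GasNetwork.Control m T, N.MemU0 h →
      (∃! w : C(Set.Icc (0 : ℝ) T, N.L2), N.IsLinearizedState hT v h w) ∧
      ∀ p w : C(Set.Icc (0 : ℝ) T, N.L2), N.IsAdjointState hT v vd p →
        N.IsLinearizedState hT v h w →
        ∫ t in 0..T, inner ℝ (N.adjointRhs hT v vd t (Set.IccExtend hT.le p t))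
            (Set.IccExtend hT.le w t) =
          ∫ t in 0..T, inner ℝ (Set.IccExtend hT.le p t)
            (N.linearizedRhs hT v h t (Set.IccExtend hT.le w t)) := by
  obtain ⟨S, hS⟩ := N.exists_c0Semigroup_opForward
  obtain ⟨S', hS'⟩ := N.exists_c0Semigroup_opAdjoint
  have hadj : ∀ x y x' y', N.opForward x y → N.opAdjoint x' y' → inner ℝ y x' = inner ℝ x y' :=
    fun _ _ _ _ => N.inner_opForward_eq
  have huniq : ∀ S₂ : GasNetwork.C0Semigroup N.L2, S₂.IsGeneratedBy N.opForward → ∀ t, 0 ≤ t →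
      S₂.op t = S.op t := fun S₂ hS₂ =>
    GasNetwork.C0Semigroup.op_eq_of_isGeneratedBy hS₂ hS hS' hadj N.dense_opForward N.dense_opAdjoint
  have huniq' : ∀ S₂ : GasNetwork.C0Semigroup N.L2, S₂.IsGeneratedBy N.opAdjoint → ∀ t, 0 ≤ t →
      S₂.op t = S'.op t := fun S₂ hS₂ =>
    GasNetwork.C0Semigroup.op_eq_of_isGeneratedBy hS₂ hS' hS
      (fun x y x' y' h h' => by rw [real_inner_comm, ← hadj _ _ _ _ h' h, real_inner_comm])
      N.dense_opAdjoint N.dense_opForward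
  have hF := N.continuousOn_frakF hK hT hv.1.1
  have hF' : ContinuousOn (fun t => ContinuousLinearMap.adjoint (N.frakF (N.fieldAt hT v t)))
      (Icc 0 T) :=
    (ContinuousLinearMap.adjoint (𝕜 := ℝ) (E := N.L2) (F := N.L2)).continuous.comp_continuousOn hF
  have hfield : ∀ v : N.VT T, ContinuousOn (fun t => N.toL2 (N.fieldAt hT v t)) (Icc 0 T) :=
    fun v => N.continuousOn_toL2 isCompact_Icc fun k i =>
      (N.continuous_fieldAt hT v k i).continuousOn
  have hg : ∀ t ∈ Icc 0 T, ∀ p, N.adjointRhs hT v vd t p =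
      ContinuousLinearMap.adjoint (N.frakF (N.fieldAt hT v t)) p +
        (N.toL2 (N.fieldAt hT v t) - N.toL2 (N.fieldAt hT vd t)) := fun t _ p =>
    add_sub_assoc _ _ _
  have hgb := (hfield v).sub (hfield vd)
  refine ⟨GasNetwork.existsUnique_isMildBackward hS' huniq' hT.le hF' hgb hg, fun h _ => ?_⟩
  -- An `H²` control and its first derivative are continuous, so the source term is continuous in
  -- time.
  obtain ⟨hB1, hB⟩ := N.continuousOn_opB (s := Icc 0 T) isCompact_Icc
    (φ := fun t k i => (h k i).val t) (φ' := fun t k i => (h k i).d1 t)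
    (fun k i => (h k i).val_mem.continuousOn hT.le) (fun k i => (h k i).d1_mem.continuousOn hT.le)
  have hfb := hB.add (hF.clm_apply hB1)
  refine ⟨GasNetwork.existsUnique_isMildForward hS huniq hT.le hF hfb fun t _ w => rfl, fun p w hp hw => ?_⟩
  have hfc : ContinuousOn (fun t => N.linearizedRhs hT v h t (IccExtend hT.le w t)) (Icc 0 T) :=
    (hF.clm_apply w.continuous.Icc_extend'.continuousOn).add hfb
  have hgc : ContinuousOn (fun t => N.adjointRhs hT v vd t (IccExtend hT.le p t)) (Icc 0 T) :=
    ((hF'.clm_apply p.continuous.Icc_extend'.continuousOn).add hgb).congr fun t ht => hg t ht _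
  exact GasNetwork.integral_inner_mild_eq
    (fun t ht x x' => GasNetwork.C0Semigroup.inner_op_eq hS hS' hadj N.dense_opForward N.dense_opAdjoint
      ht x x') hT.le hfc hgc ((GasNetwork.isMildForward_iff hS huniq hfc).1 hw)
    fun t ht => GasNetwork.IsMildBackward.eq_integral huniq' hp ht
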